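/- Call a function $f:\mathbb{R}^d\to[0,\infty)$ log-concave if $f=e^{-V}$ for a convex function $V:\mathbb{R}^d\to\mathbb{R}\cup\{+\infty\}$, and let $$[\mathrm{Cov}_{\mathbb{R}^d}(f)]_{ij}=\frac{\int x_ix_jf(x)\,dx}{\int f}-\frac{\int x_if(x)\,dx\int x_jf(x)\,dx}{\left(\int f\right)^2},\qquad \sigma(f)=\det\left(\mathrm{Cov}_{\mathbb{R}^d}(f)\right)^{\frac1{2d}}.$$ For $A\in\mathbb{R}$ say that $f$ is almost isotropic with implied constant $A$ if $|\mathrm{Cov}_{\mathbb{R}^d}(f)_{ii}-\sigma(f)^2|\le A\,\sigma(f)$ for all $i$ and $|\mathrm{Cov}_{\mathbb{R}^d}(f)_{ij}|\le A\,\sigma(f)$ for all $i\ne j$. For a p.m.f. $p$ on $\mathbb{Z}^d$ let $\mathrm{Cov}_{\mathbb{Z}^d}(p)_{ij}=\sum_k k_ik_jp(k)-\sum_k k_ip(k)\sum_k k_jp(k)$. Theorem. Let $d\ge1$. There is a constant $C'_d>0$, depending only on $d$, such that for every $A$ there is a number $N=N(d,A)$ with the following property. Let $p$ be a p.m.f.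 on $\mathbb{Z}^d$ which is log-concave with almost isotropic extension, that is, there is a log-concave function $f$ on $\mathbb{R}^d$ (not necessarily a probability density) with $f(k)=p(k)$ for all $k\in\mathbb{Z}^d$ which is almost isotropic with implied constant $A$. If $\det(\mathrm{Cov}_{\mathbb{R}^d}(f))\ge N$, then $$\max_{k\in\mathbb{Z}^d}p(k)\le\frac{C'_d}{\det\left(\mathrm{Cov}_{\mathbb{Z}^d}(p)\right)^{1/2}}.$$ -/

import Mathlib

open MeasureTheory

/-- A function `V : ℝ^d → ℝ ∪ {+∞}` (an `EReal`-valued function that omits `-∞`) is convex. -/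
def ConvexExtended {d : ℕ} (V : (Fin d → ℝ) → EReal) : Prop :=
  (∀ x, V x ≠ ⊥) ∧
    ∀ (x y : Fin d → ℝ) (a b : ℝ), 0 < a → 0 < b → a + b = 1 →
      V (a • x + b • y) ≤ (a : EReal) * V x + (b : EReal) * V y

/-- `f : ℝ^d → [0, ∞)` is log-concave: `f = e^{-V}` with `V : ℝ^d → ℝ ∪ {+∞}` convex
(and `e^{-∞} = 0`). -/
def IsLogConcave {d : ℕ} (f : (Fin d → ℝ) → ℝ) : Prop :=
  ∃ V : (Fin d → ℝ) → EReal, ConvexExtended V ∧ ∀ x, f x = (EReal.exp (-V x)).toReal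

/-- `f` is a log-concave extension to `ℝ^d` of the probability mass function `p` on `ℤ^d`.
A p.m.f. is (extensible) log-concave when it has such an extension. -/
def IsLogConcaveExtension {d : ℕ} (p : PMF (Fin d → ℤ)) (f : (Fin d → ℝ) → ℝ) : Prop :=
  IsLogConcave f ∧ ∀ k : Fin d → ℤ, f (fun i => (k i : ℝ)) = (p k).toReal

/-- The covariance matrix of a non-negative, not necessarily normalised, function on `ℝ^d`.
If `f` is log-concave with `0 < ∫ f < ∞`, then all the integrals converge; if `f` is not integrable
or `∫ f = 0`, this is the zero matrix. -/
noncomputable def covR {d : ℕ} (f : (Fin d → ℝ) → ℝ) : Matrix (Fin d) (Fin d) ℝ :=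
  Matrix.of fun i j =>
    (∫ x, x i * x j * f x) / (∫ x, f x)
      - ((∫ x, x i * f x) * (∫ x, x j * f x)) / (∫ x, f x) ^ 2

/-- The covariance matrix of a probability mass function on `ℤ^d`. -/
noncomputable def covZ {d : ℕ} (p : PMF (Fin d → ℤ)) : Matrix (Fin d) (Fin d) ℝ :=
  Matrix.of fun i j =>
    (∑' k : Fin d → ℤ, (k i : ℝ) * (k j : ℝ) * (p k).toReal)
      - (∑' k : Fin d → ℤ, (k i : ℝ) * (p k).toReal)
        * (∑' k : Fin d → ℤ, (k j : ℝ) * (p k).toReal)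

/-- The parameter `σ = det(Cov f)^{1/(2d)}`. -/
noncomputable def sigmaR {d : ℕ} (f : (Fin d → ℝ) → ℝ) : ℝ :=
  (covR f).det ^ (1 / (2 * (d : ℝ)))

/-- `f` is almost isotropic with implied constant `A`: the diagonal entries of `Cov f` are
`σ² + O(σ)` and the off-diagonal ones are `O(σ)`, all error terms being at most `A σ`.
A family of functions is almost isotropic as `σ → ∞` when, for some `A`, this holds for all its
members whose `σ` is large enough. -/
def AlmostIsotropic {d : ℕ} (A : ℝ) (f : (Fin d → ℝ) → ℝ) : Prop :=
  (∀ i, |covR f i i - sigmaR f ^ 2| ≤ A * sigmaR f) ∧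
    ∀ i j, i ≠ j → |covR f i j| ≤ A * sigmaR f

/-! Translating `f` by its barycentre, dilating by σ and normalising gives a centred log-concave
density. Once σ is large in terms of `A`, its covariance has diagonal at most 2 and quadratic form
at least half the Euclidean one. All such densities `g` share a profile with constants depending
only on `d`: for some height `S`, `g` is at least `t * S` on a ball of radius `c` about the origin
and at most `8 * S * exp (-κ ‖x‖)` everywhere (`exists_profile`).

Scaled back, `p` has a plateau of radius `c σ` and exponential decay at scale σ. The plateau holds
of order σ^d lattice points, so total mass 1 forces its height to be O(σ^(-d)). The decay then makes
second moments O(σ²), hence det Cov_ℤ(p) is O(σ^(2d)), and the product of max p with the root of the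
determinant is bounded (`exists_bound_of_profile`). Only one-sided bounds are used; lattice sums are
never compared with integrals.

The profile rests on one device: √g(u) √g(x) ≤ g((u + x)/2), integrated in x, where the midpoint map
costs a factor 2^d. With Chebyshev it makes `g` drop far out, and log-concavity along segments turns
the drop into exponential decay. For the plateau, mean zero, a variance bounded below and a third
moment bounded above put in each half-space θ · x > c (∑|θᵢ| = 1) a point where `g` is comparable to
its supremum. Superlevel sets are convex, so by Hahn–Banach such a set contains a ball. -/

/-- Multiplicative form of log-concavity for a non-negative real-valued function. -/
structure MulLogConcave {d : ℕ} (g : (Fin d → ℝ) → ℝ) : Prop where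
  nonneg : ∀ x, 0 ≤ g x
  rpow_mul_rpow_le : ∀ (x y : Fin d → ℝ) (a b : ℝ), 0 < a → 0 < b → a + b = 1 →
    g x ^ a * g y ^ b ≤ g (a • x + b • y)

lemma IsLogConcave.mulLogConcave {d : ℕ} {f : (Fin d → ℝ) → ℝ} (hf : IsLogConcave f) :
    MulLogConcave f := by
  obtain ⟨V, ⟨hbot, hconv⟩, hfV⟩ := hf
  refine ⟨fun x => by rw [hfV]; exact ENNReal.toReal_nonneg, fun x y a b ha hb hab => ?_⟩
  have hnn : 0 ≤ f (a • x + b • y) := by rw [hfV]; exact ENNReal.toReal_nonneg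
  have htop : ∀ z, V z = ⊤ → f z = 0 := fun z hz => by rw [hfV, hz]; simp
  have hreal : ∀ z (r : ℝ), V z = r → f z = Real.exp (-r) := fun z r hz => by
    rw [hfV, hz, ← EReal.coe_neg, EReal.exp_coe, ENNReal.toReal_ofReal (Real.exp_pos _).le]
  by_cases hx : V x = ⊤
  · rw [htop x hx, Real.zero_rpow ha.ne', zero_mul]; exact hnn
  by_cases hy : V y = ⊤
  · rw [htop y hy, Real.zero_rpow hb.ne', mul_zero]; exact hnn
  have hx' := EReal.coe_toReal hx (hbot x)
  have hy' := EReal.coe_toReal hy (hbot y)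
  have h := hconv x y a b ha hb hab
  rw [← hx', ← hy', ← EReal.coe_mul, ← EReal.coe_mul, ← EReal.coe_add] at h
  have hz : V (a • x + b • y) ≠ ⊤ := fun hz => by
    rw [hz, top_le_iff] at h; exact EReal.coe_ne_top _ h
  have hz' := EReal.coe_toReal hz (hbot _)
  rw [← hz', EReal.coe_le_coe_iff] at h
  rw [hreal _ _ hx'.symm, hreal _ _ hy'.symm, hreal _ _ hz'.symm, ← Real.exp_mul, ← Real.exp_mul,
    ← Real.exp_add]
  apply Real.exp_le_exp.2
  linarith

/-! ### Affine substitutions and the midpoint inequality -/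

lemma integral_comp_add_smul {d : ℕ} (h : (Fin d → ℝ) → ℝ) (u : Fin d → ℝ) {r : ℝ} (hr : 0 < r) :
    ∫ x, h (u + r • x) = (r ^ d)⁻¹ * ∫ x, h x := by
  rw [Measure.integral_comp_smul volume (fun x => h (u + x)) r, integral_add_left_eq_self,
    Module.finrank_fin_fun, abs_of_pos (by positivity), smul_eq_mul]

lemma Integrable.comp_add_smul {d : ℕ} {h : (Fin d → ℝ) → ℝ} (hh : Integrable h)
    (u : Fin d → ℝ) {r : ℝ} (hr : 0 < r) : Integrable fun x => h (u + r • x) :=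
  (hh.comp_add_left u).comp_smul hr.ne'

lemma integral_comp_midpoint {d : ℕ} (h : (Fin d → ℝ) → ℝ) (u : Fin d → ℝ) :
    ∫ x, h ((1 / 2 : ℝ) • u + (1 / 2 : ℝ) • x) = 2 ^ d * ∫ x, h x := by
  rw [integral_comp_add_smul h _ (by norm_num)]
  simp

namespace MulLogConcave

variable {d : ℕ} {g : (Fin d → ℝ) → ℝ}

lemma sqrt_mul_sqrt_le (hg : MulLogConcave g) (x y : Fin d → ℝ) :
    √(g x) * √(g y) ≤ g ((1 / 2 : ℝ) • x + (1 / 2 : ℝ) • y) := by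
  rw [Real.sqrt_eq_rpow, Real.sqrt_eq_rpow]
  exact hg.rpow_mul_rpow_le x y _ _ (by norm_num) (by norm_num) (by norm_num)

/-- Points where `g` is small compared with `g u` carry little mass compared with midpoints. -/
lemma le_sqrt_mul_midpoint (hg : MulLogConcave g) {u x : Fin d → ℝ} {s : ℝ} (hs : 0 ≤ s)
    (hx : g x ≤ s ^ 2 * g u) :
    g x ≤ s * g ((1 / 2 : ℝ) • u + (1 / 2 : ℝ) • x) := by
  have h1 : √(g x) ≤ s * √(g u) := by
    rw [← Real.sqrt_sq hs, ← Real.sqrt_mul (sq_nonneg s)]; exact Real.sqrt_le_sqrt hx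
  calc g x = √(g x) * √(g x) := (Real.mul_self_sqrt (hg.nonneg x)).symm
    _ ≤ s * √(g u) * √(g x) := by gcongr
    _ = s * (√(g u) * √(g x)) := by ring
    _ ≤ _ := by gcongr; exact hg.sqrt_mul_sqrt_le u x

lemma convex_superlevel (hg : MulLogConcave g) {s : ℝ} (hs : 0 < s) :
    Convex ℝ {x | s ≤ g x} := by
  rw [convex_iff_forall_pos]
  intro x hx y hy a b ha hb hab
  simp only [Set.mem_ofPred_eq] at *
  calc s = s ^ a * s ^ b := by rw [← Real.rpow_add hs, hab, Real.rpow_one]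
    _ ≤ g x ^ a * g y ^ b := by have := hg.nonneg x; gcongr
    _ ≤ _ := hg.rpow_mul_rpow_le x y a b ha hb hab

/-- Integrating the midpoint inequality in one variable gives √g(x) ∫√g ≤ 2^d ∫g. The same
inequality against a fixed point where `g` is positive shows that √g is integrable. -/
lemma bddAbove_range (hg : MulLogConcave g) (hi : Integrable g) (hpos : 0 < ∫ x, g x) :
    BddAbove (Set.range g) := by
  obtain ⟨u, hu⟩ : ∃ u, 0 < g u := by
    by_contra! h
    have : g = 0 := funext fun x => le_antisymm (h x) (hg.nonneg x)
    simp [this] at hpos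
  have hmeas : AEStronglyMeasurable (fun x => √(g x)) :=
    Real.continuous_sqrt.comp_aestronglyMeasurable hi.aestronglyMeasurable
  have hsi : Integrable fun x => √(g x) := by
    refine ((Integrable.comp_add_smul hi ((1 / 2 : ℝ) • u) (r := 1 / 2)
      (by norm_num)).const_mul (√(g u))⁻¹).mono' hmeas (ae_of_all _ fun x => ?_)
    rw [Real.norm_of_nonneg (Real.sqrt_nonneg _), inv_mul_eq_div,
      le_div_iff₀ (Real.sqrt_pos.2 hu), mul_comm]
    exact hg.sqrt_mul_sqrt_le u x
  have hspos : 0 < ∫ x, √(g x) := by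
    refine lt_of_le_of_ne (integral_nonneg fun x => Real.sqrt_nonneg _) fun h => hpos.ne' ?_
    have h0 := (integral_eq_zero_iff_of_nonneg (fun x => Real.sqrt_nonneg _) hsi).1 h.symm
    rw [integral_eq_zero_iff_of_nonneg hg.nonneg hi]
    filter_upwards [h0] with x hx
    exact le_antisymm (Real.sqrt_eq_zero'.1 hx) (hg.nonneg x)
  refine ⟨((2 ^ d * ∫ x, g x) / ∫ x, √(g x)) ^ 2, ?_⟩
  rintro _ ⟨x, rfl⟩
  refine (Real.sqrt_le_left (by positivity)).1 ?_
  rw [le_div_iff₀ hspos, ← integral_const_mul, ← integral_comp_midpoint g x]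
  exact integral_mono (hsi.const_mul _) (Integrable.comp_add_smul hi _ (by norm_num))
    fun y => hg.sqrt_mul_sqrt_le x y

end MulLogConcave

/-! ### Near-isotropic densities: drop away from the origin -/

/-- A log-concave probability density in near-isotropic position. -/
structure NearIsotropicDensity {d : ℕ} (g : (Fin d → ℝ) → ℝ) : Prop extends MulLogConcave g where
  integrable : Integrable g
  integral_eq_one : ∫ x, g x = 1
  integral_coord : ∀ i, ∫ x, x i * g x = 0
  integrable_sq : ∀ i, Integrable fun x : Fin d → ℝ => x i ^ 2 * g x
  integral_sq_le : ∀ i, ∫ x, x i ^ 2 * g x ≤ 2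
  le_integral_sq : ∀ θ : Fin d → ℝ, (∑ i, θ i ^ 2) / 2 ≤ ∫ x, (∑ i, θ i * x i) ^ 2 * g x

namespace NearIsotropicDensity

variable {d : ℕ} {g : (Fin d → ℝ) → ℝ}

lemma norm_sq_le_sum_sq (x : Fin d → ℝ) : ‖x‖ ^ 2 ≤ ∑ i, x i ^ 2 := by
  refine (Real.le_sqrt (norm_nonneg _) (by positivity)).1 ?_
  rw [pi_norm_le_iff_of_nonneg (by positivity)]
  intro i
  refine Real.le_sqrt_of_sq_le ?_
  rw [Real.norm_eq_abs, sq_abs]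
  exact Finset.single_le_sum (f := fun i => x i ^ 2) (fun i _ => sq_nonneg _) (Finset.mem_univ i)

lemma integrable_norm_sq (hg : NearIsotropicDensity g) : Integrable fun x => ‖x‖ ^ 2 * g x := by
  refine (integrable_finsetSum Finset.univ fun i _ => hg.integrable_sq i).mono'
    ((by fun_prop : Continuous fun x : Fin d → ℝ => ‖x‖ ^ 2).aestronglyMeasurable.mul
      hg.integrable.aestronglyMeasurable) (ae_of_all _ fun x => ?_)
  rw [Real.norm_of_nonneg (mul_nonneg (sq_nonneg _) (hg.nonneg x)), ← Finset.sum_mul]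
  exact mul_le_mul_of_nonneg_right (norm_sq_le_sum_sq x) (hg.nonneg x)

lemma integral_norm_sq_le (hg : NearIsotropicDensity g) : ∫ x, ‖x‖ ^ 2 * g x ≤ 2 * d := by
  calc ∫ x, ‖x‖ ^ 2 * g x ≤ ∫ x, ∑ i, x i ^ 2 * g x := by
        refine integral_mono hg.integrable_norm_sq
          (integrable_finsetSum Finset.univ fun i _ => hg.integrable_sq i) fun x => ?_
        simp only [← Finset.sum_mul]
        exact mul_le_mul_of_nonneg_right (norm_sq_le_sum_sq x) (hg.nonneg x)
    _ = ∑ i, ∫ x, x i ^ 2 * g x := integral_finsetSum _ fun i _ => hg.integrable_sq i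
    _ ≤ ∑ _i : Fin d, (2 : ℝ) := Finset.sum_le_sum fun i _ => hg.integral_sq_le i
    _ = 2 * d := by simp [mul_comm]

/-- Far from the origin the density is well below its supremum. -/
lemma sqrt_le_of_norm_ge (hg : NearIsotropicDensity g) {R S : ℝ} (hR : 0 < R)
    (hR2 : R ^ 2 = 8 * (d + 1) * 2 ^ d) (hS : ∀ x, g x ≤ S) {y : Fin d → ℝ}
    (hy : 3 * R ≤ ‖y‖) : √(g y) ≤ √S / 3 := by
  have hS0 : 0 ≤ S := (hg.nonneg y).trans (hS y)
  -- If ‖x‖ < R, the midpoint of x and y has norm at least R. The two quadratic weights replace the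
  -- indicators of the ball and of its complement, so that only the second moment enters.
  have hpt : ∀ x, (1 - ‖x‖ ^ 2 / R ^ 2) * g x * √(g y) ≤
      √S * ((‖(1 / 2 : ℝ) • y + (1 / 2 : ℝ) • x‖ ^ 2 / R ^ 2) *
        g ((1 / 2 : ℝ) • y + (1 / 2 : ℝ) • x)) := by
    intro x
    have hz := hg.nonneg ((1 / 2 : ℝ) • y + (1 / 2 : ℝ) • x)
    rcases le_or_gt R ‖x‖ with hx | hx
    · have : 1 ≤ ‖x‖ ^ 2 / R ^ 2 := by
        rw [one_le_div (by positivity)]; gcongr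
      refine le_trans (b := 0) ?_ (by positivity)
      exact mul_nonpos_of_nonpos_of_nonneg
        (mul_nonpos_of_nonpos_of_nonneg (by linarith) (hg.nonneg x)) (Real.sqrt_nonneg _)
    · have hn : R ≤ ‖(1 / 2 : ℝ) • y + (1 / 2 : ℝ) • x‖ := by
        have h1 : ‖(1 / 2 : ℝ) • y‖ ≤ ‖(1 / 2 : ℝ) • y + (1 / 2 : ℝ) • x‖ + ‖(1 / 2 : ℝ) • x‖ := by
          simpa using norm_sub_le ((1 / 2 : ℝ) • y + (1 / 2 : ℝ) • x) ((1 / 2 : ℝ) • x)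
        rw [norm_smul, norm_smul, Real.norm_of_nonneg (by norm_num)] at h1
        linarith
      have h1 : 1 ≤ ‖(1 / 2 : ℝ) • y + (1 / 2 : ℝ) • x‖ ^ 2 / R ^ 2 := by
        rw [one_le_div (by positivity)]; gcongr
      have h2 : 1 - ‖x‖ ^ 2 / R ^ 2 ≤ 1 := by
        have : 0 ≤ ‖x‖ ^ 2 / R ^ 2 := by positivity
        linarith
      calc (1 - ‖x‖ ^ 2 / R ^ 2) * g x * √(g y) ≤ 1 * g x * √(g y) := by
            gcongr; exact hg.nonneg x
        _ = √(g x) * (√(g y) * √(g x)) := by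
            rw [one_mul]; nth_rewrite 1 [← Real.mul_self_sqrt (hg.nonneg x)]; ring
        _ ≤ √S * g ((1 / 2 : ℝ) • y + (1 / 2 : ℝ) • x) := by
            gcongr
            · exact hS x
            · exact hg.sqrt_mul_sqrt_le y x
        _ ≤ _ := by
            gcongr; exact le_mul_of_one_le_left hz h1
  have hiq : Integrable fun x => ‖x‖ ^ 2 / R ^ 2 * g x := by
    simpa [div_eq_inv_mul, mul_assoc] using hg.integrable_norm_sq.const_mul (R ^ 2)⁻¹
  have hI : ∫ x, ‖x‖ ^ 2 / R ^ 2 * g x = (∫ x, ‖x‖ ^ 2 * g x) / R ^ 2 := by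
    rw [← integral_div]; congr 1; ext x; ring
  have hmono := integral_mono
    (((hg.integrable.sub hiq).mul_const (√(g y))).congr
      (ae_of_all _ fun x => by simp only [Pi.sub_apply]; ring))
    ((Integrable.comp_add_smul hiq ((1 / 2 : ℝ) • y) (r := 1 / 2) (by norm_num)).const_mul √S) hpt
  have hL : ∫ x, (1 - ‖x‖ ^ 2 / R ^ 2) * g x * √(g y) =
      (1 - (∫ x, ‖x‖ ^ 2 * g x) / R ^ 2) * √(g y) := by
    have : ∫ x, (1 - ‖x‖ ^ 2 / R ^ 2) * g x = ∫ x, g x - ‖x‖ ^ 2 / R ^ 2 * g x := by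
      congr 1; ext x; ring
    rw [integral_mul_const, ← hI, this, integral_sub hg.integrable hiq, hg.integral_eq_one]
  rw [hL, integral_const_mul, integral_comp_midpoint (fun x => ‖x‖ ^ 2 / R ^ 2 * g x) y, hI] at hmono
  -- `R` is chosen so that the mass beyond radius `R` stays at most 1/4 after the midpoint factor
  -- 2^d.
  have hq : (∫ x, ‖x‖ ^ 2 * g x) / R ^ 2 ≤ 1 / (4 * 2 ^ d) := by
    rw [div_le_div_iff₀ (by positivity) (by positivity), hR2]
    nlinarith [hg.integral_norm_sq_le, pow_pos (two_pos (α := ℝ)) d]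
  have h2d : (1 : ℝ) ≤ 2 ^ d := one_le_pow₀ (by norm_num)
  have hq' : 1 / (4 * (2 : ℝ) ^ d) ≤ 1 / 4 := by
    apply one_div_le_one_div_of_le <;> linarith
  have h3 : (2 : ℝ) ^ d * ((∫ x, ‖x‖ ^ 2 * g x) / R ^ 2) ≤ 1 / 4 := by
    calc (2 : ℝ) ^ d * ((∫ x, ‖x‖ ^ 2 * g x) / R ^ 2) ≤ 2 ^ d * (1 / (4 * 2 ^ d)) := by gcongr
      _ = 1 / 4 := by field_simp
  have h4 := mul_le_mul_of_nonneg_left h3 (Real.sqrt_nonneg S)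
  have h5 : 3 / 4 * √(g y) ≤ (1 - (∫ x, ‖x‖ ^ 2 * g x) / R ^ 2) * √(g y) := by
    gcongr; linarith
  linarith

end NearIsotropicDensity

/-! ### Near-isotropic densities: exponential decay, third moment and plateau -/

namespace NearIsotropicDensity

variable {d : ℕ} {g : (Fin d → ℝ) → ℝ}

/-- The supremum need not be attained; a point above half of it serves as reference. -/
lemma exists_near_max (hg : NearIsotropicDensity g) :
    ∃ u, 0 < g u ∧ ∀ x, g x ≤ 2 * g u := by
  have hpos : 0 < ∫ x, g x := by rw [hg.integral_eq_one]; exact one_pos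
  have hbdd := hg.toMulLogConcave.bddAbove_range hg.integrable hpos
  obtain ⟨v, hv⟩ : ∃ v, 0 < g v := by
    by_contra! h
    have : g = 0 := funext fun x => le_antisymm (h x) (hg.nonneg x)
    simp [this] at hpos
  have hS : 0 < ⨆ x, g x := hv.trans_le (le_ciSup hbdd v)
  obtain ⟨u, hu⟩ := exists_lt_of_lt_ciSup (half_lt_self hS)
  exact ⟨u, (half_pos hS).trans hu, fun x => (le_ciSup hbdd x).trans (by linarith)⟩

lemma le_half_of_norm_ge (hg : NearIsotropicDensity g) {R : ℝ} (hR : 0 < R)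
    (hR2 : R ^ 2 = 8 * (d + 1) * 2 ^ d) {u : Fin d → ℝ} (hu : ∀ x, g x ≤ 2 * g u)
    {y : Fin d → ℝ} (hy : 3 * R ≤ ‖y‖) : g y ≤ g u / 2 := by
  have h := hg.sqrt_le_of_norm_ge hR hR2 hu hy
  have h0 := hg.nonneg u
  have h1 := Real.sq_sqrt (hg.nonneg y)
  have h2 := Real.sq_sqrt (show 0 ≤ 2 * g u by linarith)
  nlinarith [Real.sqrt_nonneg (g y), Real.sqrt_nonneg (2 * g u)]

/-- If `g` is at most `g u / 2` outside the ball of radius `3 R`, then it decays exponentially. -/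
lemma le_exp_of_norm_sub_gt (hg : MulLogConcave g) {R : ℝ} (hR : 0 < R) {u : Fin d → ℝ}
    (hu : 0 < g u) (hnu : ‖u‖ ≤ 3 * R) (hfar : ∀ y, 3 * R ≤ ‖y‖ → g y ≤ g u / 2)
    {x : Fin d → ℝ} (hx : 6 * R < ‖x - u‖) :
    g x ≤ g u * Real.exp (-(Real.log 2 / (6 * R)) * ‖x - u‖) := by
  rcases (hg.nonneg x).eq_or_lt with h0 | hpos
  · rw [← h0]; positivity
  set r := ‖x - u‖ with hr
  have hr0 : 0 < r := by linarith
  -- The point `y` below lies on the segment from u to x at distance 6R from u, hence outside the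
  -- ball of radius 3R. Log-concavity extrapolates the halving at `y` out to x.
  set l := 6 * R / r with hl
  have hl0 : 0 < l := by positivity
  have hl1 : l < 1 := (div_lt_one hr0).2 hx
  set y := (1 - l) • u + l • x with hy
  have hyu : y - u = l • (x - u) := by rw [hy]; module
  have hny : 3 * R ≤ ‖y‖ := by
    have h1 : ‖y - u‖ = 6 * R := by
      rw [hyu, norm_smul, Real.norm_of_nonneg hl0.le, ← hr, hl]; field_simp
    have h2 := norm_sub_le y u
    linarith
  have hlc := (hg.rpow_mul_rpow_le u x (1 - l) l (by linarith) hl0 (by ring)).trans (hfar y hny)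
  have hlog := Real.log_le_log (by positivity) hlc
  rw [Real.log_mul (by positivity) (by positivity), Real.log_rpow hu, Real.log_rpow hpos,
    Real.log_div hu.ne' (by norm_num)] at hlog
  have h3 : l * (Real.log (g x) - Real.log (g u)) ≤ -Real.log 2 := by linarith
  have h4 : Real.log (g x) - Real.log (g u) ≤ -(Real.log 2 / (6 * R)) * r := by
    have : Real.log (g x) - Real.log (g u) ≤ -Real.log 2 / l := by
      rw [le_div_iff₀ hl0]; linarith
    refine this.trans (le_of_eq ?_)
    rw [hl]; field_simp
  rw [← Real.log_le_log_iff hpos (by positivity), Real.log_mul hu.ne' (Real.exp_pos _).ne',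
    Real.log_exp]
  linarith

lemma exists_exp_decay (d : ℕ) :
    ∃ ρ κ : ℝ, 0 < ρ ∧ 0 < κ ∧ ∀ g : (Fin d → ℝ) → ℝ, NearIsotropicDensity g →
      ∃ u, 0 < g u ∧ ‖u‖ ≤ ρ ∧ ∀ x, g x ≤ 8 * g u * Real.exp (-κ * ‖x‖) := by
  set R : ℝ := √(8 * (d + 1) * 2 ^ d) with hRdef
  have hR : 0 < R := Real.sqrt_pos.2 (by positivity)
  have hR2 : R ^ 2 = 8 * (d + 1) * 2 ^ d := Real.sq_sqrt (by positivity)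
  have hlog : 0 < Real.log 2 := Real.log_pos (by norm_num)
  refine ⟨3 * R, Real.log 2 / (6 * R), by positivity, by positivity, fun g hg => ?_⟩
  obtain ⟨u, hu, hmax⟩ := hg.exists_near_max
  have hfar : ∀ y, 3 * R ≤ ‖y‖ → g y ≤ g u / 2 := fun y hy => hg.le_half_of_norm_ge hR hR2 hmax hy
  have hnu : ‖u‖ ≤ 3 * R := by
    by_contra! h
    have := hfar u h.le
    linarith
  refine ⟨u, hu, hnu, fun x => ?_⟩
  set κ := Real.log 2 / (6 * R) with hκ
  have hκ0 : 0 < κ := by positivity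
  have hκR : κ * R = Real.log 2 / 6 := by rw [hκ]; field_simp
  have htri : ‖x‖ ≤ ‖x - u‖ + 3 * R := by
    have := norm_add_le (x - u) u
    rw [sub_add_cancel] at this
    linarith
  have htri' := mul_le_mul_of_nonneg_left htri hκ0.le
  -- Recentring at the origin shifts the norm by at most 3R, which costs at most a factor 2 in the
  -- far case. In the near case ‖x‖ ≤ 9R, so the exponential is at least 1/4, and 2 = 8 · 1/4.
  rcases lt_or_ge (6 * R) ‖x - u‖ with hx | hx
  · have hexp : Real.exp (-κ * ‖x - u‖) ≤ 8 * Real.exp (-κ * ‖x‖) := by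
      have h2 : (2 : ℝ) = Real.exp (Real.log 2) := (Real.exp_log (by norm_num)).symm
      calc Real.exp (-κ * ‖x - u‖) ≤ Real.exp (Real.log 2 + -κ * ‖x‖) :=
            Real.exp_le_exp.2 (by nlinarith)
        _ = 2 * Real.exp (-κ * ‖x‖) := by rw [Real.exp_add, ← h2]
        _ ≤ _ := by gcongr; norm_num
    calc g x ≤ g u * Real.exp (-κ * ‖x - u‖) :=
          le_exp_of_norm_sub_gt hg.toMulLogConcave hR hu hnu hfar hx
      _ ≤ g u * (8 * Real.exp (-κ * ‖x‖)) := by gcongr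
      _ = _ := by ring
  · have hx' := mul_le_mul_of_nonneg_left hx hκ0.le
    have hexp : 1 / 4 ≤ Real.exp (-κ * ‖x‖) := by
      have h4 : (1 / 4 : ℝ) = Real.exp (-(2 * Real.log 2)) := by
        rw [Real.exp_neg, two_mul, Real.exp_add, Real.exp_log (by norm_num)]; norm_num
      rw [h4]
      exact Real.exp_le_exp.2 (by nlinarith)
    calc g x ≤ 2 * g u := hmax x
      _ = 8 * g u * (1 / 4) := by ring
      _ ≤ _ := by gcongr

lemma norm_le_two_mul_norm_midpoint_add (u x : Fin d → ℝ) :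
    ‖x‖ ≤ 2 * ‖(1 / 2 : ℝ) • u + (1 / 2 : ℝ) • x‖ + ‖u‖ := by
  have h : x = (2 : ℝ) • ((1 / 2 : ℝ) • u + (1 / 2 : ℝ) • x) - u := by module
  calc ‖x‖ = ‖(2 : ℝ) • ((1 / 2 : ℝ) • u + (1 / 2 : ℝ) • x) - u‖ := by rw [← h]
    _ ≤ ‖(2 : ℝ) • ((1 / 2 : ℝ) • u + (1 / 2 : ℝ) • x)‖ + ‖u‖ := norm_sub_le _ _
    _ = _ := by rw [norm_smul, Real.norm_of_nonneg (by norm_num)]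

/-- The decay gives g(x) ≤ (3e)² g(u) with e = exp(-κ‖x‖/2), so the midpoint inequality yields g(x)
≤ 3e g(z) at the midpoint z. The factor e absorbs one power of ‖x‖ and the second moment handles the
rest; the bound is free of the unknown height g(u). -/
lemma integrable_norm_pow_three (hg : NearIsotropicDensity g) {ρ κ : ℝ} (hκ : 0 < κ)
    {u : Fin d → ℝ} (hu : ‖u‖ ≤ ρ) (hdecay : ∀ x, g x ≤ 8 * g u * Real.exp (-κ * ‖x‖)) :
    Integrable (fun x => ‖x‖ ^ 3 * g x) ∧
      ∫ x, ‖x‖ ^ 3 * g x ≤ 6 / κ * (2 ^ d * (16 * d + 2 * ρ ^ 2)) := by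
  have hpt : ∀ x, ‖x‖ ^ 3 * g x ≤ 6 / κ * ((8 * ‖(1 / 2 : ℝ) • u + (1 / 2 : ℝ) • x‖ ^ 2 + 2 * ρ ^ 2) *
      g ((1 / 2 : ℝ) • u + (1 / 2 : ℝ) • x)) := by
    intro x
    set e := Real.exp (-(κ * ‖x‖ / 2)) with he
    have he0 : 0 < e := Real.exp_pos _
    have hee : e ^ 2 = Real.exp (-κ * ‖x‖) := by
      rw [he, sq, ← Real.exp_add]; congr 1; ring
    have h1 : g x ≤ 3 * e * g ((1 / 2 : ℝ) • u + (1 / 2 : ℝ) • x) := by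
      refine hg.le_sqrt_mul_midpoint (by positivity) ((hdecay x).trans ?_)
      rw [mul_pow, hee]
      nlinarith [mul_nonneg (hg.nonneg u) (Real.exp_pos (-κ * ‖x‖)).le]
    have h2 : ‖x‖ * e ≤ 2 / κ := by
      rw [he, Real.exp_neg, ← div_eq_mul_inv, div_le_div_iff₀ (Real.exp_pos _) hκ]
      nlinarith [Real.add_one_le_exp (κ * ‖x‖ / 2)]
    set z := (1 / 2 : ℝ) • u + (1 / 2 : ℝ) • x with hz
    have h3 : ‖x‖ ^ 2 ≤ 8 * ‖z‖ ^ 2 + 2 * ρ ^ 2 := by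
      have h4 : ‖x‖ ≤ 2 * ‖z‖ + ρ := (norm_le_two_mul_norm_midpoint_add u x).trans (by linarith)
      have h5 := pow_le_pow_left₀ (norm_nonneg x) h4 2
      nlinarith [sq_nonneg (2 * ‖z‖ - ρ)]
    have hgz := hg.nonneg z
    calc ‖x‖ ^ 3 * g x ≤ ‖x‖ ^ 3 * (3 * e * g z) := by gcongr
      _ = 3 * (‖x‖ * e) * (‖x‖ ^ 2 * g z) := by ring
      _ ≤ 3 * (2 / κ) * ((8 * ‖z‖ ^ 2 + 2 * ρ ^ 2) * g z) := by gcongr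
      _ = _ := by ring
  have hi0 : Integrable fun x => (8 * ‖x‖ ^ 2 + 2 * ρ ^ 2) * g x :=
    ((hg.integrable_norm_sq.const_mul 8).add (hg.integrable.const_mul (2 * ρ ^ 2))).congr
      (ae_of_all _ fun x => by simp only [Pi.add_apply]; ring)
  have hi := (Integrable.comp_add_smul hi0 ((1 / 2 : ℝ) • u) (r := 1 / 2) (by norm_num)).const_mul
    (6 / κ)
  have hint : Integrable (fun x => ‖x‖ ^ 3 * g x) :=
    hi.mono' ((by fun_prop : Continuous fun x : Fin d → ℝ => ‖x‖ ^ 3).aestronglyMeasurable.mul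
      hg.integrable.aestronglyMeasurable) (ae_of_all _ fun x => by
        rw [Real.norm_of_nonneg (mul_nonneg (by positivity) (hg.nonneg x))]; exact hpt x)
  refine ⟨hint, (integral_mono hint hi hpt).trans ?_⟩
  rw [integral_const_mul,
    integral_comp_midpoint (fun x => (8 * ‖x‖ ^ 2 + 2 * ρ ^ 2) * g x) u]
  have hI : ∫ x, (8 * ‖x‖ ^ 2 + 2 * ρ ^ 2) * g x = 8 * (∫ x, ‖x‖ ^ 2 * g x) + 2 * ρ ^ 2 := by
    have : ∫ x, (8 * ‖x‖ ^ 2 + 2 * ρ ^ 2) * g x =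
        ∫ x, 8 * (‖x‖ ^ 2 * g x) + 2 * ρ ^ 2 * g x := by congr 1; ext x; ring
    rw [this, integral_add (hg.integrable_norm_sq.const_mul 8) (hg.integrable.const_mul _),
      integral_const_mul, integral_const_mul, hg.integral_eq_one, mul_one]
  rw [hI]
  have hle : 8 * (∫ x, ‖x‖ ^ 2 * g x) + 2 * ρ ^ 2 ≤ 16 * d + 2 * ρ ^ 2 := by
    linarith [hg.integral_norm_sq_le]
  gcongr

lemma abs_sum_mul_le {θ : Fin d → ℝ} (x : Fin d → ℝ) :
    |∑ i, θ i * x i| ≤ (∑ i, |θ i|) * ‖x‖ := by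
  rw [Finset.sum_mul]
  refine (Finset.abs_sum_le_sum_abs _ _).trans (Finset.sum_le_sum fun i _ => ?_)
  rw [abs_mul]
  exact mul_le_mul_of_nonneg_left (norm_le_pi_norm x i) (abs_nonneg _)

lemma integrable_coord (hg : NearIsotropicDensity g) (i : Fin d) :
    Integrable fun x : Fin d → ℝ => x i * g x := by
  refine (hg.integrable.add (hg.integrable_sq i)).mono'
    ((by fun_prop : Continuous fun x : Fin d → ℝ => x i).aestronglyMeasurable.mul
      hg.integrable.aestronglyMeasurable) (ae_of_all _ fun x => ?_)
  rw [norm_mul, Real.norm_of_nonneg (hg.nonneg x), Pi.add_apply, Real.norm_eq_abs]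
  nlinarith [hg.nonneg x, mul_nonneg (hg.nonneg x) (sq_nonneg (|x i| - 1)), sq_abs (x i),
    mul_nonneg (hg.nonneg x) (abs_nonneg (x i))]

/-- Every linear functional takes values bounded below on the set where `g` is not too small. -/
lemma exists_lt_sum_mul (hg : NearIsotropicDensity g) {ρ T c s : ℝ} (hT : 0 < T)
    (h3i : Integrable (fun x => ‖x‖ ^ 3 * g x)) (h3 : ∫ x, ‖x‖ ^ 3 * g x ≤ T)
    {u : Fin d → ℝ} (hu : ‖u‖ ≤ ρ) (hc : 0 ≤ c) (hs : 0 ≤ s)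
    (hcs : c + s * (2 ^ d * (2 * d + (1 + ρ))) < 1 / (32 * (d + 1) ^ 2 * T))
    {θ : Fin d → ℝ} (hθ : ∑ i, |θ i| = 1) :
    ∃ x, c < ∑ i, θ i * x i ∧ s ^ 2 * g u < g x := by
  -- Since Z has mean zero, its positive part has mean half of E|Z|. This is bounded below by the
  -- moments, whereas smallness of `g` on the half-space Z > c would make it too small.
  by_contra! hcon
  set Z : (Fin d → ℝ) → ℝ := fun x => ∑ i, θ i * x i with hZ
  have hZn : ∀ x, |Z x| ≤ ‖x‖ := fun x => by simpa [hθ] using abs_sum_mul_le (θ := θ) x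
  have hZc : Continuous Z := by fun_prop
  have hgm := hg.integrable.aestronglyMeasurable
  have hD : (0 : ℝ) < d + 1 := by positivity
  have hZi : Integrable fun x => Z x * g x := by
    refine (integrable_finsetSum Finset.univ fun i _ =>
      (hg.integrable_coord i).const_mul (θ i)).congr (ae_of_all _ fun x => ?_)
    simp only [hZ, Finset.sum_mul, mul_assoc]
  have hZ0 : ∫ x, Z x * g x = 0 := by
    have : ∫ x, Z x * g x = ∫ x, ∑ i, θ i * (x i * g x) := by
      congr 1; ext x; simp only [hZ, Finset.sum_mul, mul_assoc]
    rw [this, integral_finsetSum _ fun i _ => (hg.integrable_coord i).const_mul (θ i)]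
    simp [integral_const_mul, hg.integral_coord]
  have habsi : Integrable fun x => |Z x| * g x :=
    hZi.abs.congr (ae_of_all _ fun x => by simp only [abs_mul, abs_of_nonneg (hg.nonneg x)])
  -- lower bound for the first absolute moment
  set K := 4 * (d + 1) * T with hK
  have hK0 : 0 < K := by positivity
  -- Truncation at level `K`: the cubic part is at most T/K = 1/(4(d+1)), half of the variance bound
  -- `hvar`.
  have hpt : ∀ x, Z x ^ 2 * g x ≤ K * (|Z x| * g x) + ‖x‖ ^ 3 * g x / K := by
    intro x
    have hz0 := abs_nonneg (Z x)
    have h1 : |Z x| ^ 2 ≤ K * |Z x| + |Z x| ^ 3 / K := by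
      rcases le_total |Z x| K with h | h
      · have : 0 ≤ |Z x| ^ 3 / K := by positivity
        nlinarith
      · have : |Z x| ^ 2 ≤ |Z x| ^ 3 / K := by
          rw [le_div_iff₀ hK0, pow_succ |Z x| 2]; gcongr
        have := mul_nonneg hK0.le hz0
        linarith
    have h2 : |Z x| ^ 3 / K ≤ ‖x‖ ^ 3 / K := by gcongr; exact hZn x
    rw [sq_abs] at h1
    calc Z x ^ 2 * g x ≤ (K * |Z x| + ‖x‖ ^ 3 / K) * g x :=
          mul_le_mul_of_nonneg_right (by linarith) (hg.nonneg x)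
      _ = _ := by ring
  have hZsqi : Integrable fun x => Z x ^ 2 * g x :=
    hg.integrable_norm_sq.mono' ((hZc.pow 2).aestronglyMeasurable.mul hgm)
      (ae_of_all _ fun x => by
        rw [Real.norm_of_nonneg (mul_nonneg (sq_nonneg _) (hg.nonneg x)), ← sq_abs (Z x)]
        have := hg.nonneg x
        gcongr
        exact hZn x)
  have hsq := integral_mono hZsqi ((habsi.const_mul K).add (h3i.div_const K)) hpt
  have hadd : ∫ x, K * (|Z x| * g x) + ‖x‖ ^ 3 * g x / K =
      K * (∫ x, |Z x| * g x) + (∫ x, ‖x‖ ^ 3 * g x) / K := by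
    rw [integral_add (habsi.const_mul K) (h3i.div_const K), integral_const_mul, integral_div]
  have hvar : 1 / (2 * (d + 1)) ≤ ∫ x, Z x ^ 2 * g x := by
    refine le_trans ?_ (hg.le_integral_sq θ)
    have hcs := sq_sum_le_card_mul_sum_sq (s := Finset.univ) (f := fun i => |θ i|)
    simp only [hθ, sq_abs, Finset.card_univ, Fintype.card_fin] at hcs
    have h0 : 0 ≤ ∑ i, θ i ^ 2 := Finset.sum_nonneg fun i _ => sq_nonneg _
    rw [div_le_div_iff₀ (by positivity) (by norm_num)]
    nlinarith
  have hTK : (∫ x, ‖x‖ ^ 3 * g x) / K ≤ 1 / (4 * (d + 1)) := by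
    rw [div_le_div_iff₀ hK0 (by positivity), hK]
    nlinarith
  have habs : 1 / (16 * (d + 1) ^ 2 * T) ≤ ∫ x, |Z x| * g x := by
    have h4 : 1 / (4 * ((d : ℝ) + 1)) ≤ K * ∫ x, |Z x| * g x := by
      have : 1 / (2 * ((d : ℝ) + 1)) = 1 / (4 * (d + 1)) + 1 / (4 * (d + 1)) := by
        field_simp; norm_num
      have h5 : ∫ x, Z x ^ 2 * g x ≤ K * (∫ x, |Z x| * g x) + (∫ x, ‖x‖ ^ 3 * g x) / K :=
        hsq.trans hadd.le
      linarith
    rw [div_le_iff₀ (by positivity)] at h4 ⊢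
    rw [hK] at h4
    linarith
  -- upper bound from the assumption that `g` is small on the half-space
  have hup : ∀ x, (|Z x| * g x + Z x * g x) / 2 ≤ c * g x +
      s * ((‖(1 / 2 : ℝ) • u + (1 / 2 : ℝ) • x‖ ^ 2 + (1 + ρ)) *
        g ((1 / 2 : ℝ) • u + (1 / 2 : ℝ) • x)) := by
    intro x
    set z := (1 / 2 : ℝ) • u + (1 / 2 : ℝ) • x with hz
    have hgz := hg.nonneg z
    have hgx := hg.nonneg x
    have hρ : 0 ≤ ρ := (norm_nonneg u).trans hu
    have hxz : ‖x‖ ≤ ‖z‖ ^ 2 + (1 + ρ) := by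
      have := norm_le_two_mul_norm_midpoint_add u x
      rw [← hz] at this
      nlinarith [sq_nonneg (‖z‖ - 1)]
    rcases le_or_gt (Z x) c with h | h
    · have h1 : (|Z x| + Z x) / 2 ≤ c := by
        rcases abs_cases (Z x) with ⟨h2, _⟩ | ⟨h2, _⟩ <;> rw [h2] <;> linarith
      have h2 : 0 ≤ s * ((‖z‖ ^ 2 + (1 + ρ)) * g z) := by positivity
      nlinarith
    · have h1 : g x ≤ s * g z := hg.le_sqrt_mul_midpoint hs (hcon x h)
      have h2 : |Z x| = Z x := abs_of_nonneg (hc.trans h.le)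
      have h3 : Z x ≤ ‖x‖ := (le_abs_self _).trans (hZn x)
      have h4 : 0 ≤ c * g x := by positivity
      have h5 : Z x * g x ≤ s * ((‖z‖ ^ 2 + (1 + ρ)) * g z) := by
        calc Z x * g x ≤ (‖z‖ ^ 2 + (1 + ρ)) * (s * g z) := by
              refine mul_le_mul (h3.trans hxz) h1 hgx (by positivity)
          _ = _ := by ring
      rw [h2]
      linarith
  have hi0 : Integrable fun x => (‖x‖ ^ 2 + (1 + ρ)) * g x :=
    (hg.integrable_norm_sq.add (hg.integrable.const_mul (1 + ρ))).congr
      (ae_of_all _ fun x => by simp only [Pi.add_apply]; ring)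
  have hi := (Integrable.comp_add_smul hi0 ((1 / 2 : ℝ) • u) (r := 1 / 2) (by norm_num)).const_mul s
  have hfin := integral_mono ((habsi.add hZi).div_const 2) ((hg.integrable.const_mul c).add hi) hup
  have hL : ∫ x, (|Z x| * g x + Z x * g x) / 2 = (∫ x, |Z x| * g x) / 2 := by
    rw [integral_div, integral_add habsi hZi, hZ0, add_zero]
  have hI : ∫ x, (‖x‖ ^ 2 + (1 + ρ)) * g x = (∫ x, ‖x‖ ^ 2 * g x) + (1 + ρ) := by
    have : ∫ x, (‖x‖ ^ 2 + (1 + ρ)) * g x =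
        ∫ x, ‖x‖ ^ 2 * g x + (1 + ρ) * g x := by congr 1; ext x; ring
    rw [this, integral_add hg.integrable_norm_sq (hg.integrable.const_mul _),
      integral_const_mul, hg.integral_eq_one, mul_one]
  have hRt : ∫ x, c * g x + s * ((‖(1 / 2 : ℝ) • u + (1 / 2 : ℝ) • x‖ ^ 2 + (1 + ρ)) *
        g ((1 / 2 : ℝ) • u + (1 / 2 : ℝ) • x)) =
      c + s * (2 ^ d * ((∫ x, ‖x‖ ^ 2 * g x) + (1 + ρ))) := by
    rw [integral_add (hg.integrable.const_mul c) hi, integral_const_mul, integral_const_mul,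
      integral_comp_midpoint (fun x => (‖x‖ ^ 2 + (1 + ρ)) * g x) u, hI, hg.integral_eq_one, mul_one]
  have hfin' : (∫ x, |Z x| * g x) / 2 ≤ c + s * (2 ^ d * ((∫ x, ‖x‖ ^ 2 * g x) + (1 + ρ))) :=
    hL.symm.le.trans (hfin.trans hRt.le)
  have hle : c + s * (2 ^ d * ((∫ x, ‖x‖ ^ 2 * g x) + (1 + ρ))) ≤
      c + s * (2 ^ d * (2 * d + (1 + ρ))) := by
    gcongr; exact hg.integral_norm_sq_le
  have hhalf : 1 / (16 * ((d : ℝ) + 1) ^ 2 * T) = 2 * (1 / (32 * (d + 1) ^ 2 * T)) := by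
    field_simp; norm_num
  linarith

/-- A convex set with empty interior is null. Then g(x) ≤ s g((u + x)/2) almost everywhere, and
integration gives 1 ≤ s 2^d. -/
lemma interior_superlevel_nonempty (hg : NearIsotropicDensity g) {u : Fin d → ℝ} (hu : 0 < g u)
    {s : ℝ} (hs : 0 < s) (hsd : s * 2 ^ d < 1) :
    (interior {x | s ^ 2 * g u ≤ g x}).Nonempty := by
  by_contra hne
  rw [Set.not_nonempty_iff_eq_empty] at hne
  have hconv := hg.toMulLogConcave.convex_superlevel (s := s ^ 2 * g u) (by positivity)
  have hnull : volume {x | s ^ 2 * g u ≤ g x} = 0 := by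
    refine measure_mono_null (fun x hx => ?_) (hconv.addHaar_frontier volume)
    rw [frontier, hne, Set.sdiff_empty]
    exact subset_closure hx
  have hae : ∀ᵐ x, g x ≤ s * g ((1 / 2 : ℝ) • u + (1 / 2 : ℝ) • x) := by
    have h : ∀ᵐ x, x ∉ {x | s ^ 2 * g u ≤ g x} := measure_eq_zero_iff_ae_notMem.1 hnull
    filter_upwards [h] with x hx
    exact hg.le_sqrt_mul_midpoint hs.le (not_le.1 hx).le
  have hmono := integral_mono_ae hg.integrable ((Integrable.comp_add_smul hg.integrable
    ((1 / 2 : ℝ) • u) (r := 1 / 2) (by norm_num)).const_mul s) hae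
  rw [integral_const_mul, integral_comp_midpoint g u, hg.integral_eq_one] at hmono
  linarith

/-- A point `y` outside the superlevel set is separated from its interior by a functional φ. Then φ
≤ φ(y) ≤ c ∑|θᵢ| on the whole set, against `exists_lt_sum_mul` for the normalised θ. -/
lemma le_of_norm_le (hg : NearIsotropicDensity g) {ρ T c s : ℝ} (hT : 0 < T)
    (h3i : Integrable (fun x => ‖x‖ ^ 3 * g x)) (h3 : ∫ x, ‖x‖ ^ 3 * g x ≤ T)
    {u : Fin d → ℝ} (hu0 : 0 < g u) (hu : ‖u‖ ≤ ρ) (hc : 0 ≤ c) (hs : 0 < s)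
    (hsd : s * 2 ^ d < 1)
    (hcs : c + s * (2 ^ d * (2 * d + (1 + ρ))) < 1 / (32 * (d + 1) ^ 2 * T))
    {y : Fin d → ℝ} (hy : ‖y‖ ≤ c) : s ^ 2 * g u ≤ g y := by
  by_contra hy'
  set L := {x | s ^ 2 * g u ≤ g x} with hL
  have hyL : y ∉ L := hy'
  have hconv : Convex ℝ L := hg.toMulLogConcave.convex_superlevel (by positivity)
  have hne : (interior L).Nonempty := hg.interior_superlevel_nonempty hu0 hs hsd
  obtain ⟨φ, hφ⟩ := geometric_hahn_banach_open_point hconv.interior isOpen_interior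
    (fun h => hyL (interior_subset h))
  have hφL : ∀ x ∈ L, φ x ≤ φ y := by
    have hcl : IsClosed {x | φ x ≤ φ y} := isClosed_le φ.continuous continuous_const
    intro x hx
    have h1 : x ∈ closure (interior L) := by
      rw [hconv.closure_interior_eq_closure_of_nonempty_interior hne]
      exact subset_closure hx
    exact closure_minimal (fun z hz => (hφ z hz).le) hcl h1
  set θ : Fin d → ℝ := fun i => φ (Pi.single i 1) with hθ
  have hφθ : ∀ x, φ x = ∑ i, θ i * x i := by
    intro x
    conv_lhs => rw [pi_eq_sum_univ' x]
    rw [map_sum]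
    refine Finset.sum_congr rfl fun i _ => ?_
    rw [map_smul, smul_eq_mul, mul_comm]
  have hW : 0 < ∑ i, |θ i| := by
    refine lt_of_le_of_ne (Finset.sum_nonneg fun i _ => abs_nonneg _) fun h => ?_
    obtain ⟨z, hz⟩ := hne
    have h1 := hφ z hz
    have h2 : ∀ x, φ x = 0 := fun x => by
      have := abs_sum_mul_le (θ := θ) x
      rw [← h, zero_mul, ← hφθ] at this
      exact abs_eq_zero.1 (le_antisymm this (abs_nonneg _))
    rw [h2, h2] at h1
    exact lt_irrefl _ h1
  set W := ∑ i, |θ i| with hWdef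
  obtain ⟨x, hx1, hx2⟩ := hg.exists_lt_sum_mul hT h3i h3 hu hc hs.le hcs (θ := fun i => θ i / W) (by
    simp only [abs_div, abs_of_pos hW, ← Finset.sum_div]
    exact div_self hW.ne')
  have h1 : ∑ i, θ i / W * x i = φ x / W := by
    rw [hφθ, Finset.sum_div]
    exact Finset.sum_congr rfl fun i _ => by ring
  rw [h1, lt_div_iff₀ hW] at hx1
  have h2 := hφL x hx2.le
  have h3 : φ y ≤ W * ‖y‖ := by
    rw [hφθ]; exact (le_abs_self _).trans (abs_sum_mul_le y)
  have h4 := mul_le_mul_of_nonneg_left hy hW.le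
  linarith

theorem exists_profile (d : ℕ) :
    ∃ c t κ : ℝ, 0 < c ∧ 0 < t ∧ 0 < κ ∧ ∀ g : (Fin d → ℝ) → ℝ, NearIsotropicDensity g →
      ∃ S : ℝ, 0 < S ∧ (∀ y, ‖y‖ ≤ c → t * S ≤ g y) ∧
        ∀ x, g x ≤ 8 * S * Real.exp (-κ * ‖x‖) := by
  obtain ⟨ρ, κ, hρ, hκ, h⟩ := exists_exp_decay d
  set T := 6 / κ * (2 ^ d * (16 * d + 2 * ρ ^ 2)) with hT
  have hT0 : 0 < T := by positivity
  set a := 1 / (32 * ((d : ℝ) + 1) ^ 2 * T) with ha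
  have ha0 : 0 < a := by positivity
  set B : ℝ := 2 ^ d * (2 * d + (1 + ρ)) with hB
  have hB0 : 0 < B := by positivity
  -- The first entry gives a/4 + s B ≤ a/2 < a, the second keeps s 2^d at most 1/2.
  set s := min (a / (4 * B)) (1 / (2 * 2 ^ d)) with hs
  have hs0 : 0 < s := by positivity
  have hs1 : s * B ≤ a / 4 := by
    calc s * B ≤ a / (4 * B) * B := by gcongr; exact min_le_left _ _
      _ = a / 4 := by field_simp
  have hs2 : s * 2 ^ d < 1 := by
    calc s * 2 ^ d ≤ 1 / (2 * 2 ^ d) * 2 ^ d := by gcongr; exact min_le_right _ _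
      _ = 1 / 2 := by field_simp
      _ < 1 := by norm_num
  refine ⟨a / 4, s ^ 2, κ, by positivity, by positivity, hκ, fun g hg => ?_⟩
  obtain ⟨u, hu, hnu, hdec⟩ := h g hg
  obtain ⟨h3i, h3⟩ := hg.integrable_norm_pow_three hκ hnu hdec
  exact ⟨g u, hu, fun y hy => hg.le_of_norm_le hT0 h3i h3 hu hnu (by positivity) hs0 hs2
    (by linarith) hy, hdec⟩

end NearIsotropicDensity

/-! ### Exponential sums and point counts on the lattice -/

section LatticeSums

lemma hasSum_pow_natAbs {r : ℝ} (hr0 : 0 ≤ r) (hr1 : r < 1) :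
    HasSum (fun j : ℤ => r ^ j.natAbs) ((1 - r)⁻¹ + r * (1 - r)⁻¹) := by
  have hgeo := hasSum_geometric_of_lt_one hr0 hr1
  have h1 : HasSum (fun n : ℕ => r ^ (n : ℤ).natAbs) (1 - r)⁻¹ := by
    simpa only [Int.natAbs_natCast] using hgeo
  have h2 : HasSum (fun n : ℕ => r ^ (-((n : ℤ) + 1)).natAbs) (r * (1 - r)⁻¹) := by
    have hn : ∀ n : ℕ, (-((n : ℤ) + 1)).natAbs = n + 1 := fun n => by omega
    simpa only [hn, pow_succ'] using hgeo.mul_left r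
  exact HasSum.of_nat_of_neg_add_one h1 h2

lemma one_div_two_mul_le_one_sub_exp {L : ℝ} (hL : 1 ≤ L) :
    1 / (2 * L) ≤ 1 - Real.exp (-(1 / L)) := by
  have h1 : 1 / L + 1 ≤ Real.exp (1 / L) := Real.add_one_le_exp _
  have h2 : Real.exp (-(1 / L)) ≤ (1 / L + 1)⁻¹ := by
    rw [Real.exp_neg]; exact inv_anti₀ (by positivity) h1
  have h3 : (1 / L + 1)⁻¹ = L / (1 + L) := by field_simp
  have h4 : L / (1 + L) ≤ 1 - 1 / (2 * L) := by
    rw [div_le_iff₀ (by linarith)]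
    have h5 : (1 - 1 / (2 * L)) * (1 + L) = L + (1 / 2 - 1 / (2 * L)) := by field_simp; ring
    have h6 : 1 / (2 * L) ≤ 1 / 2 := one_div_le_one_div_of_le (by norm_num) (by linarith)
    linarith
  linarith

/-- Rounding the centre moves it by at most 1, which costs exp(1/L) ≤ e < 3. -/
lemma exp_neg_abs_sub_le (k : ℤ) (a : ℝ) {L : ℝ} (hL : 1 ≤ L) :
    Real.exp (-(|k - a| / L)) ≤ 3 * Real.exp (-(1 / L)) ^ (k - ⌊a⌋).natAbs := by
  have hL0 : 0 < L := by linarith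
  have h1 : ((k - ⌊a⌋).natAbs : ℝ) ≤ |k - a| + 1 := by
    have h2 := abs_sub_le (k : ℝ) a ⌊a⌋
    have h3 : |a - ⌊a⌋| ≤ 1 := by
      rw [abs_of_nonneg (by linarith [Int.floor_le a])]
      linarith [Int.lt_floor_add_one a]
    rw [Nat.cast_natAbs, Int.cast_abs, Int.cast_sub]
    linarith
  have h4 := div_le_div_of_nonneg_right h1 hL0.le
  have h5 : 1 / L ≤ 1 := by rw [div_le_one hL0]; exact hL
  rw [add_div] at h4
  have h6 : ((k - ⌊a⌋).natAbs : ℝ) * -(1 / L) = -((k - ⌊a⌋).natAbs / L) := by ring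
  have h7 : Real.exp 1 ≤ 3 := by linarith [Real.exp_one_lt_d9]
  calc Real.exp (-(|k - a| / L)) ≤ Real.exp (1 + (k - ⌊a⌋).natAbs * -(1 / L)) := by
        apply Real.exp_le_exp.2
        rw [h6]
        linarith
    _ = Real.exp 1 * Real.exp (-(1 / L)) ^ (k - ⌊a⌋).natAbs := by
        rw [Real.exp_add, Real.exp_nat_mul]
    _ ≤ _ := mul_le_mul_of_nonneg_right h7 (pow_nonneg (Real.exp_pos _).le _)

lemma sum_exp_neg_abs_sub_le (s : Finset ℤ) (a : ℝ) {L : ℝ} (hL : 1 ≤ L) :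
    ∑ k ∈ s, Real.exp (-(|k - a| / L)) ≤ 12 * L := by
  have hpt := fun k : ℤ => exp_neg_abs_sub_le k a hL
  have hgap := one_div_two_mul_le_one_sub_exp hL
  have hr0 : 0 ≤ Real.exp (-(1 / L)) := (Real.exp_pos _).le
  generalize Real.exp (-(1 / L)) = r at hpt hgap hr0
  have hpos : 0 < 1 / (2 * L) := by positivity
  have hr1 : r < 1 := by linarith
  have hinv : (1 - r)⁻¹ ≤ 2 * L := by
    have := inv_anti₀ hpos hgap
    rwa [one_div, inv_inv] at this
  have hinv0 : 0 < (1 - r)⁻¹ := inv_pos.2 (by linarith)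
  have hZ : HasSum (fun k : ℤ => r ^ (k - ⌊a⌋).natAbs) ((1 - r)⁻¹ + r * (1 - r)⁻¹) := by
    have h := ((Equiv.subRight ⌊a⌋).hasSum_iff (f := fun j : ℤ => r ^ j.natAbs)).2
      (hasSum_pow_natAbs hr0 hr1)
    simpa only [Function.comp_def, Equiv.subRight_apply] using h
  have hs := sum_le_hasSum s (fun k _ => pow_nonneg hr0 _) hZ
  have hle := Finset.sum_le_sum fun k (_ : k ∈ s) => hpt k
  rw [← Finset.mul_sum] at hle
  nlinarith

variable {d : ℕ}

/-- The inclusion of the integer lattice. -/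
def latticeCast (k : Fin d → ℤ) : Fin d → ℝ := fun i => (k i : ℝ)

/-- The sup norm dominates the average of the coordinates, so the exponential is at most a product
and the sum over an enclosing box factorises. -/
lemma sum_exp_neg_norm_sub_le (hd : 1 ≤ d) (s : Finset (Fin d → ℤ)) (m : Fin d → ℝ) {L : ℝ}
    (hL : 1 ≤ d * L) :
    ∑ k ∈ s, Real.exp (-(‖latticeCast k - m‖ / L)) ≤ (12 * (d * L)) ^ d := by
  classical
  have hd0 : (0 : ℝ) < d := by exact_mod_cast hd
  have hL0 : 0 < L := by
    by_contra! h
    nlinarith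
  set t : Fin d → Finset ℤ := fun i => s.image fun k => k i with ht
  have hst : s ⊆ Fintype.piFinset t := fun k hk =>
    Fintype.mem_piFinset.2 fun i => Finset.mem_image_of_mem _ hk
  have hpt : ∀ k : Fin d → ℤ, Real.exp (-(‖latticeCast k - m‖ / L)) ≤
      ∏ i, Real.exp (-(|k i - m i| / (d * L))) := by
    intro k
    rw [← Real.exp_sum]
    apply Real.exp_le_exp.2
    rw [Finset.sum_neg_distrib, neg_le_neg_iff, ← Finset.sum_div,
      div_le_div_iff₀ (by positivity) hL0]
    have h : ∑ i, |(k i : ℝ) - m i| ≤ ∑ _i : Fin d, ‖latticeCast k - m‖ :=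
      Finset.sum_le_sum fun i _ => norm_le_pi_norm (latticeCast k - m) i
    simp only [Finset.sum_const, Finset.card_univ, Fintype.card_fin, nsmul_eq_mul] at h
    nlinarith
  calc ∑ k ∈ s, Real.exp (-(‖latticeCast k - m‖ / L))
      ≤ ∑ k ∈ s, ∏ i, Real.exp (-(|k i - m i| / (d * L))) := Finset.sum_le_sum fun k _ => hpt k
    _ ≤ ∑ k ∈ Fintype.piFinset t, ∏ i, Real.exp (-(|k i - m i| / (d * L))) :=
        Finset.sum_le_sum_of_subset_of_nonneg hst fun k _ _ => by positivity
    _ = ∏ i, ∑ j ∈ t i, Real.exp (-(|j - m i| / (d * L))) :=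
        (Finset.prod_univ_sum t fun i (j : ℤ) => Real.exp (-(|j - m i| / (d * L)))).symm
    _ ≤ ∏ _i : Fin d, 12 * (d * L) :=
        Finset.prod_le_prod (fun i _ => by positivity) fun i _ =>
          sum_exp_neg_abs_sub_le (t i) (m i) hL
    _ = _ := by simp

/-- Half of the exponential decay absorbs the quadratic factor. -/
lemma sum_norm_sq_mul_exp_le (hd : 1 ≤ d) (s : Finset (Fin d → ℤ)) (m : Fin d → ℝ) {L : ℝ}
    (hL0 : 0 < L) (hL : 1 ≤ d * (2 * L)) :
    ∑ k ∈ s, ‖latticeCast k - m‖ ^ 2 * Real.exp (-(‖latticeCast k - m‖ / L)) ≤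
      8 * L ^ 2 * (12 * (d * (2 * L))) ^ d := by
  calc ∑ k ∈ s, ‖latticeCast k - m‖ ^ 2 * Real.exp (-(‖latticeCast k - m‖ / L))
      ≤ ∑ k ∈ s, 8 * L ^ 2 * Real.exp (-(‖latticeCast k - m‖ / (2 * L))) := by
        refine Finset.sum_le_sum fun k _ => ?_
        set r := ‖latticeCast k - m‖ with hr
        have hr0 : 0 ≤ r := norm_nonneg _
        have h1 := Real.quadratic_le_exp_of_nonneg (x := r / (2 * L)) (by positivity)
        have h2 : Real.exp (-(r / L)) =
            Real.exp (-(r / (2 * L))) * (Real.exp (r / (2 * L)))⁻¹ := by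
          rw [← Real.exp_neg, ← Real.exp_add]; congr 1; field_simp; ring
        have h3 : r ^ 2 ≤ 8 * L ^ 2 * Real.exp (r / (2 * L)) := by
          have h4 : r ^ 2 = 8 * L ^ 2 * ((r / (2 * L)) ^ 2 / 2) := by field_simp; ring
          have h5 : 0 ≤ r / (2 * L) := by positivity
          rw [h4]
          gcongr
          linarith
        rw [h2]
        calc r ^ 2 * (Real.exp (-(r / (2 * L))) * (Real.exp (r / (2 * L)))⁻¹)
            ≤ 8 * L ^ 2 * Real.exp (r / (2 * L)) *
              (Real.exp (-(r / (2 * L))) * (Real.exp (r / (2 * L)))⁻¹) := by gcongr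
          _ = _ := by field_simp
    _ = 8 * L ^ 2 * ∑ k ∈ s, Real.exp (-(‖latticeCast k - m‖ / (2 * L))) := by
        rw [Finset.mul_sum]
    _ ≤ _ := by
        gcongr
        exact sum_exp_neg_norm_sub_le hd s m hL

/-- Each interval [mᵢ - r, mᵢ + r] contains at least 2r - 1 ≥ r integers. -/
lemma exists_finset_norm_sub_le (m : Fin d → ℝ) {r : ℝ} (hr : 1 ≤ r) :
    ∃ s : Finset (Fin d → ℤ), (∀ k ∈ s, ‖latticeCast k - m‖ ≤ r) ∧ r ^ d ≤ s.card := by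
  classical
  refine ⟨Fintype.piFinset fun i => Finset.Icc ⌈m i - r⌉ ⌊m i + r⌋, fun k hk => ?_, ?_⟩
  · rw [pi_norm_le_iff_of_nonneg (by linarith)]
    intro i
    have h := Finset.mem_Icc.1 (Fintype.mem_piFinset.1 hk i)
    have h1 := Int.ceil_le.1 h.1
    have h2 := Int.le_floor.1 h.2
    rw [Real.norm_eq_abs, abs_le]
    simp only [latticeCast, Pi.sub_apply]
    constructor <;> linarith
  · rw [Fintype.card_piFinset, Nat.cast_prod]
    calc r ^ d = ∏ _i : Fin d, r := by simp
      _ ≤ _ := Finset.prod_le_prod (fun i _ => by linarith) fun i _ => by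
        rw [Int.card_Icc]
        have h1 := Int.ceil_lt_add_one (m i - r)
        have h2 := Int.lt_floor_add_one (m i + r)
        have h3 : ((⌊m i + r⌋ + 1 - ⌈m i - r⌉ : ℤ) : ℝ) ≤
            ((⌊m i + r⌋ + 1 - ⌈m i - r⌉).toNat : ℝ) := by
          exact_mod_cast Int.self_le_toNat _
        push_cast at h3
        linarith

end LatticeSums

/-! ### Covariance on the lattice and the bound from a profile -/

section DiscreteCovariance

variable {d : ℕ} {p : PMF (Fin d → ℤ)}

lemma hasSum_toReal (p : PMF (Fin d → ℤ)) : HasSum (fun k => (p k).toReal) 1 := by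
  have h := ENNReal.hasSum_toReal (f := p) (by rw [p.tsum_coe]; exact ENNReal.one_ne_top)
  rwa [← ENNReal.tsum_toReal_eq (fun k => p.apply_ne_top k), p.tsum_coe, ENNReal.toReal_one] at h

/-- All coordinates of `p` have a second moment. -/
def HasSecondMoment (p : PMF (Fin d → ℤ)) : Prop :=
  ∀ i, Summable fun k : Fin d → ℤ => (k i : ℝ) ^ 2 * (p k).toReal

namespace HasSecondMoment

lemma summable_mul (hp : HasSecondMoment p) (i j : Fin d) :
    Summable fun k : Fin d → ℤ => (k i : ℝ) * (k j : ℝ) * (p k).toReal := by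
  refine Summable.of_norm_bounded ((hp i).add (hp j)) fun k => ?_
  rw [norm_mul, Real.norm_of_nonneg ENNReal.toReal_nonneg, ← add_mul, Real.norm_eq_abs]
  refine mul_le_mul_of_nonneg_right ?_ ENNReal.toReal_nonneg
  rw [abs_le]
  constructor <;> nlinarith [sq_nonneg ((k i : ℝ) + k j), sq_nonneg ((k i : ℝ) - k j)]

lemma summable_coord (hp : HasSecondMoment p) (i : Fin d) :
    Summable fun k : Fin d → ℤ => (k i : ℝ) * (p k).toReal := by
  refine Summable.of_norm_bounded ((hp i).add (hasSum_toReal p).summable) fun k => ?_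
  rw [norm_mul, Real.norm_of_nonneg ENNReal.toReal_nonneg, ← add_one_mul, Real.norm_eq_abs]
  refine mul_le_mul_of_nonneg_right ?_ ENNReal.toReal_nonneg
  rw [abs_le]
  constructor <;> nlinarith [sq_nonneg ((k i : ℝ) + 1), sq_nonneg ((k i : ℝ) - 1)]

lemma hasSum_sub_mul_sub (hp : HasSecondMoment p) (a : Fin d → ℝ) (i j : Fin d) :
    HasSum (fun k : Fin d → ℤ => ((k i : ℝ) - a i) * ((k j : ℝ) - a j) * (p k).toReal)
      (covZ p i j + ((∑' k : Fin d → ℤ, (k i : ℝ) * (p k).toReal) - a i) *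
        ((∑' k : Fin d → ℤ, (k j : ℝ) * (p k).toReal) - a j)) := by
  have h := (((hp.summable_mul i j).hasSum.sub
    ((hp.summable_coord i).hasSum.mul_left (a j))).sub
    ((hp.summable_coord j).hasSum.mul_left (a i))).add ((hasSum_toReal p).mul_left (a i * a j))
  have hval : covZ p i j + ((∑' k : Fin d → ℤ, (k i : ℝ) * (p k).toReal) - a i) *
        ((∑' k : Fin d → ℤ, (k j : ℝ) * (p k).toReal) - a j) =
      (∑' k : Fin d → ℤ, (k i : ℝ) * (k j : ℝ) * (p k).toReal) -
        a j * (∑' k : Fin d → ℤ, (k i : ℝ) * (p k).toReal) -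
        a i * (∑' k : Fin d → ℤ, (k j : ℝ) * (p k).toReal) + a i * a j * 1 := by
    simp only [covZ, Matrix.of_apply]; ring
  rw [hval]
  exact h.congr_fun fun k => by ring

/-- The variance is at most the second moment about any point, and |ab| ≤ (a² + b²)/2 handles the
off-diagonal entries. -/
lemma abs_covZ_le (hp : HasSecondMoment p) {m : Fin d → ℝ} {H : ℝ}
    (hH : ∀ i, ∑' k : Fin d → ℤ, ((k i : ℝ) - m i) ^ 2 * (p k).toReal ≤ H) (i j : Fin d) :
    |covZ p i j| ≤ H := by
  set μ : Fin d → ℝ := fun i => ∑' k : Fin d → ℤ, (k i : ℝ) * (p k).toReal with hμ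
  have hcov : ∀ i j, HasSum (fun k : Fin d → ℤ =>
      ((k i : ℝ) - μ i) * ((k j : ℝ) - μ j) * (p k).toReal) (covZ p i j) := fun i j => by
    simpa [hμ] using hp.hasSum_sub_mul_sub μ i j
  have hdiag : ∀ i, covZ p i i ≤ H := fun i => by
    have h := (hp.hasSum_sub_mul_sub m i i).tsum_eq
    simp only [← sq] at h
    have := hH i
    rw [h] at this
    nlinarith [sq_nonneg ((∑' k : Fin d → ℤ, (k i : ℝ) * (p k).toReal) - m i)]
  have hav := ((hcov i i).add (hcov j j)).div_const 2
  have h1 : covZ p i j ≤ (covZ p i i + covZ p j j) / 2 := by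
    refine hasSum_le (fun k => ?_) (hcov i j) hav
    have hq : 0 ≤ (p k).toReal := ENNReal.toReal_nonneg
    nlinarith [mul_nonneg hq (sq_nonneg (((k i : ℝ) - μ i) - ((k j : ℝ) - μ j)))]
  have h2 : -covZ p i j ≤ (covZ p i i + covZ p j j) / 2 := by
    refine hasSum_le (fun k => ?_) (hcov i j).neg hav
    have hq : 0 ≤ (p k).toReal := ENNReal.toReal_nonneg
    nlinarith [mul_nonneg hq (sq_nonneg (((k i : ℝ) - μ i) + ((k j : ℝ) - μ j)))]
  rw [abs_le]
  constructor <;> linarith [hdiag i, hdiag j]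

/-- A functional with zero variance is constant on the support, but its values at k₀ and k₀ + eᵢ
differ by vᵢ. Positivity of the determinant is essential later: division by zero gives 0, and the
final bound would fail. -/
lemma posDef_covZ (hp : HasSecondMoment p) {k₀ : Fin d → ℤ} (h0 : 0 < (p k₀).toReal)
    (h1 : ∀ i, 0 < (p (k₀ + Pi.single i 1)).toReal) : (covZ p).PosDef := by
  set μ : Fin d → ℝ := fun i => ∑' k : Fin d → ℤ, (k i : ℝ) * (p k).toReal with hμ
  have hcov : ∀ i j, HasSum (fun k : Fin d → ℤ =>
      ((k i : ℝ) - μ i) * ((k j : ℝ) - μ j) * (p k).toReal) (covZ p i j) := fun i j => by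
    simpa [hμ] using hp.hasSum_sub_mul_sub μ i j
  refine Matrix.PosDef.of_dotProduct_mulVec_pos ?_ fun v hv => ?_
  · ext i j
    simp only [Matrix.conjTranspose_apply, star_trivial, covZ, Matrix.of_apply]
    congr 1
    · exact tsum_congr fun k => by ring
    · ring
  · have hsum : HasSum (fun k : Fin d → ℤ => (∑ i, v i * ((k i : ℝ) - μ i)) ^ 2 * (p k).toReal)
        (star v ⬝ᵥ (covZ p).mulVec v) := by
      have h := hasSum_sum (s := Finset.univ) fun i (_ : i ∈ Finset.univ) =>
        (hasSum_sum (s := Finset.univ) fun j (_ : j ∈ Finset.univ) =>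
          (hcov i j).mul_right (v j)).mul_left (v i)
      refine HasSum.congr_fun h fun k => ?_
      rw [sq, Finset.sum_mul_sum, Finset.sum_mul]
      refine Finset.sum_congr rfl fun i _ => ?_
      rw [Finset.sum_mul, Finset.mul_sum]
      exact Finset.sum_congr rfl fun j _ => by ring
    rw [← hsum.tsum_eq]
    have hnn : ∀ k : Fin d → ℤ, 0 ≤ (∑ i, v i * ((k i : ℝ) - μ i)) ^ 2 * (p k).toReal :=
      fun k => mul_nonneg (sq_nonneg _) ENNReal.toReal_nonneg
    obtain ⟨i, hi⟩ := Function.ne_iff.1 hv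
    by_cases hz : ∑ i, v i * ((k₀ i : ℝ) - μ i) = 0
    · refine hsum.summable.tsum_pos hnn (k₀ + Pi.single i 1) (mul_pos ?_ (h1 i))
      have : ∑ j, v j * (((k₀ + Pi.single i 1 : Fin d → ℤ) j : ℝ) - μ j) = v i := by
        have h2 : ∀ j, v j * (((k₀ + Pi.single i 1 : Fin d → ℤ) j : ℝ) - μ j) =
            v j * ((k₀ j : ℝ) - μ j) + v j * (Pi.single i (1 : ℝ) : Fin d → ℝ) j := fun j => by
          by_cases hj : j = i
          · subst hj; simp; ring
          · simp [hj]
        simp only [h2, Finset.sum_add_distrib, hz, zero_add]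
        simp [Pi.single_apply]
      rw [this]
      exact sq_pos_of_ne_zero hi
    · exact hsum.summable.tsum_pos hnn k₀ (mul_pos (by positivity) h0)

end HasSecondMoment

/-- The bound for a p.m.f. with a plateau at scale `σ` and exponential decay at the same scale. -/
theorem exists_bound_of_profile {d : ℕ} (hd : 1 ≤ d) {c t κ : ℝ} (hc : 0 < c) (ht : 0 < t)
    (hκ : 0 < κ) :
    ∃ C σ₀ : ℝ, 0 < C ∧ ∀ σ : ℝ, σ₀ ≤ σ → 0 < σ →
      ∀ (p : PMF (Fin d → ℤ)) (m : Fin d → ℝ) (S : ℝ), 0 < S →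
        (∀ k, ‖latticeCast k - m‖ ≤ c * σ → t * S ≤ (p k).toReal) →
        (∀ k, (p k).toReal ≤ 8 * S * Real.exp (-(‖latticeCast k - m‖ / (σ / κ)))) →
        ∀ k, (p k).toReal ≤ C / √(covZ p).det := by
  have hd0 : (0 : ℝ) < d := by exact_mod_cast hd
  set B := 64 / κ ^ 2 * (24 * d / κ) ^ d / (t * c ^ d) with hB
  have hB0 : 0 < B := by positivity
  -- σ ≥ 2/c puts the rounding of `m` and its neighbours in the plateau; σ ≥ κ/(2d) gives the scale
  -- condition of the lattice sums.
  refine ⟨8 / (t * c ^ d) * √(d.factorial * B ^ d), max (2 / c) (κ / (2 * d)), by positivity, ?_⟩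
  intro σ hσ hσ0 p m S hS hlow hup k
  have hr : 2 ≤ c * σ := by
    have := (le_max_left _ _).trans hσ
    rw [div_le_iff₀ hc] at this
    linarith
  have hL : 1 ≤ d * (2 * (σ / κ)) := by
    have := (le_max_right _ _).trans hσ
    rw [div_le_iff₀ (by positivity)] at this
    have h2 : d * (2 * (σ / κ)) = σ * (2 * d) / κ := by ring
    rw [h2, le_div_iff₀ hκ]
    linarith
  have hq0 : ∀ k, 0 ≤ (p k).toReal := fun k => ENNReal.toReal_nonneg
  -- the plateau bounds the height
  have hSle : S ≤ 1 / (t * (c * σ) ^ d) := by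
    obtain ⟨s, hs, hcard⟩ := exists_finset_norm_sub_le m (r := c * σ) (by linarith)
    rw [le_div_iff₀ (by positivity)]
    calc S * (t * (c * σ) ^ d) = (c * σ) ^ d * (t * S) := by ring
      _ ≤ s.card * (t * S) := by gcongr
      _ = ∑ _k ∈ s, t * S := by simp
      _ ≤ ∑ k ∈ s, (p k).toReal := Finset.sum_le_sum fun k hk => hlow k (hs k hk)
      _ ≤ 1 := sum_le_hasSum s (fun k _ => hq0 k) (hasSum_toReal p)
  -- second moments
  have hsec : ∀ s : Finset (Fin d → ℤ),
      ∑ k ∈ s, ‖latticeCast k - m‖ ^ 2 * (p k).toReal ≤ B * σ ^ 2 := by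
    intro s
    calc ∑ k ∈ s, ‖latticeCast k - m‖ ^ 2 * (p k).toReal
        ≤ ∑ k ∈ s, 8 * S * (‖latticeCast k - m‖ ^ 2 *
            Real.exp (-(‖latticeCast k - m‖ / (σ / κ)))) := by
          refine Finset.sum_le_sum fun k _ => ?_
          calc ‖latticeCast k - m‖ ^ 2 * (p k).toReal ≤ ‖latticeCast k - m‖ ^ 2 *
                (8 * S * Real.exp (-(‖latticeCast k - m‖ / (σ / κ)))) := by gcongr; exact hup k
            _ = _ := by ring
      _ = 8 * S * ∑ k ∈ s, ‖latticeCast k - m‖ ^ 2 *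
            Real.exp (-(‖latticeCast k - m‖ / (σ / κ))) := by rw [Finset.mul_sum]
      _ ≤ 8 * (1 / (t * (c * σ) ^ d)) *
            (8 * (σ / κ) ^ 2 * (12 * (d * (2 * (σ / κ)))) ^ d) := by
          gcongr
          exact sum_norm_sq_mul_exp_le hd s m (by positivity) hL
      _ = B * σ ^ 2 := by
          have h1 : 12 * (d * (2 * (σ / κ))) = 24 * d / κ * σ := by ring
          rw [hB, h1, mul_pow c σ d, mul_pow _ σ d]
          field_simp
          norm_num
  have hsumm : Summable fun k : Fin d → ℤ => ‖latticeCast k - m‖ ^ 2 * (p k).toReal :=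
    summable_of_sum_le (fun k => mul_nonneg (sq_nonneg _) (hq0 k)) hsec
  have hcoord : ∀ i (k : Fin d → ℤ), ((k i : ℝ) - m i) ^ 2 ≤ ‖latticeCast k - m‖ ^ 2 := by
    intro i k
    rw [← sq_abs]
    gcongr
    exact norm_le_pi_norm (latticeCast k - m) i
  have hp : HasSecondMoment p := by
    intro i
    refine Summable.of_nonneg_of_le (fun k => mul_nonneg (sq_nonneg _) (hq0 k)) (fun k => ?_)
      ((hsumm.mul_left 2).add ((hasSum_toReal p).summable.mul_left (2 * m i ^ 2)))
    have h1 : (k i : ℝ) ^ 2 ≤ 2 * ‖latticeCast k - m‖ ^ 2 + 2 * m i ^ 2 := by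
      nlinarith [hcoord i k, sq_nonneg ((k i : ℝ) - 2 * m i)]
    have := mul_le_mul_of_nonneg_right h1 (hq0 k)
    linarith
  have hH : ∀ i, ∑' k : Fin d → ℤ, ((k i : ℝ) - m i) ^ 2 * (p k).toReal ≤ B * σ ^ 2 := by
    intro i
    refine Real.tsum_le_of_sum_le (fun k => mul_nonneg (sq_nonneg _) (hq0 k)) fun s => ?_
    exact (Finset.sum_le_sum fun k _ =>
      mul_le_mul_of_nonneg_right (hcoord i k) (hq0 k)).trans (hsec s)
  -- Leibniz expansion: d! terms, each a product of `d` entries of size at most B σ².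
  have hdet : (covZ p).det ≤ d.factorial * (B * σ ^ 2) ^ d := by
    have h := Matrix.det_le (A := covZ p) (abv := AbsoluteValue.abs) (x := B * σ ^ 2)
      fun i j => hp.abs_covZ_le hH i j
    rw [Fintype.card_fin, nsmul_eq_mul] at h
    exact (le_abs_self _).trans h
  -- nondegeneracy
  have hpos : ∀ k, ‖latticeCast k - m‖ ≤ c * σ → 0 < (p k).toReal := fun k hk =>
    (mul_pos ht hS).trans_le (hlow k hk)
  have hround : ∀ i, |((round (m i) : ℤ) : ℝ) - m i| ≤ 1 / 2 := fun i => by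
    rw [abs_sub_comm]; exact abs_sub_round (m i)
  have hdet0 : 0 < (covZ p).det := by
    refine (hp.posDef_covZ (k₀ := fun i => round (m i)) (hpos _ ?_) fun i => hpos _ ?_).det_pos
    · rw [pi_norm_le_iff_of_nonneg (by linarith)]
      intro j
      exact (hround j).trans (by linarith)
    · rw [pi_norm_le_iff_of_nonneg (by linarith)]
      intro j
      have h1 : |((Pi.single i 1 : Fin d → ℤ) j : ℝ)| ≤ 1 := by
        by_cases hj : j = i
        · subst hj; simp
        · simp [hj]
      have h2 : (latticeCast ((fun i => round (m i)) + Pi.single i 1) - m : Fin d → ℝ) j =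
          (((round (m j) : ℤ) : ℝ) - m j) + ((Pi.single i 1 : Fin d → ℤ) j : ℝ) := by
        simp only [latticeCast, Pi.sub_apply, Pi.add_apply]
        push_cast
        ring
      rw [h2, Real.norm_eq_abs]
      exact (abs_add_le _ _).trans (by linarith [hround j])
  rw [le_div_iff₀ (Real.sqrt_pos.2 hdet0)]
  have hpk : (p k).toReal ≤ 8 * (1 / (t * (c * σ) ^ d)) := by
    refine (hup k).trans ?_
    have : Real.exp (-(‖latticeCast k - m‖ / (σ / κ))) ≤ 1 :=
      Real.exp_le_one_iff.2 (neg_nonpos.2 (by positivity))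
    calc 8 * S * Real.exp (-(‖latticeCast k - m‖ / (σ / κ))) ≤ 8 * S * 1 := by gcongr
      _ = 8 * S := mul_one _
      _ ≤ _ := by gcongr
  have hsqrt : √(covZ p).det ≤ √(d.factorial * B ^ d) * σ ^ d := by
    refine (Real.sqrt_le_sqrt hdet).trans (le_of_eq ?_)
    rw [mul_pow, ← mul_assoc, ← pow_mul, mul_comm 2 d, pow_mul, Real.sqrt_mul (by positivity),
      Real.sqrt_sq (by positivity)]
  calc (p k).toReal * √(covZ p).det
      ≤ 8 * (1 / (t * (c * σ) ^ d)) * (√(d.factorial * B ^ d) * σ ^ d) := by gcongr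
    _ = _ := by rw [mul_pow]; field_simp

end DiscreteCovariance

/-! ### Normalisation of an almost isotropic function -/

section Rescaling

variable {d : ℕ} {f : (Fin d → ℝ) → ℝ}

lemma MulLogConcave.const_mul_comp_add_smul (hf : MulLogConcave f) {K : ℝ} (hK : 0 < K)
    (m : Fin d → ℝ) (σ : ℝ) : MulLogConcave fun x => K * f (m + σ • x) := by
  refine ⟨fun x => mul_nonneg hK.le (hf.nonneg _), fun x y a b ha hb hab => ?_⟩
  have harg : m + σ • (a • x + b • y) = a • (m + σ • x) + b • (m + σ • y) := by
    have h : m = a • m + b • m := by rw [← add_smul, hab, one_smul]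
    nth_rewrite 1 [h]
    module
  have hKK : K ^ a * K ^ b = K := by rw [← Real.rpow_add hK, hab, Real.rpow_one]
  simp only [harg]
  rw [Real.mul_rpow hK.le (hf.nonneg _), Real.mul_rpow hK.le (hf.nonneg _)]
  calc K ^ a * f (m + σ • x) ^ a * (K ^ b * f (m + σ • y) ^ b)
      = (K ^ a * K ^ b) * (f (m + σ • x) ^ a * f (m + σ • y) ^ b) := by ring
    _ ≤ K * f (a • (m + σ • x) + b • (m + σ • y)) := by
      rw [hKK]
      gcongr
      exact hf.rpow_mul_rpow_le _ _ a b ha hb hab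

/-- The barycentre of a non-negative function. -/
noncomputable def barycentre (f : (Fin d → ℝ) → ℝ) : Fin d → ℝ :=
  fun i => (∫ x, x i * f x) / ∫ x, f x

/-- A non-integrable function has integral 0 by convention, and then all entries of `covR` vanish; a
positive entry thus certifies integrability. -/
lemma integrable_of_covR_pos (hf : MulLogConcave f) {i : Fin d} (hi : 0 < covR f i i) :
    Integrable f ∧ 0 < ∫ x, f x := by
  have hI : ∫ x, f x ≠ 0 := fun h => by simp [covR, h] at hi
  exact ⟨not_imp_comm.1 integral_undef hI,
    lt_of_le_of_ne (integral_nonneg hf.nonneg) hI.symm⟩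

lemma integrable_sq_of_covR_pos {i : Fin d} (hi : 0 < covR f i i) :
    Integrable fun x : Fin d → ℝ => x i ^ 2 * f x := by
  by_contra h
  have h0 : ∫ x : Fin d → ℝ, x i * x i * f x = 0 := by
    rw [← integral_undef h]; simp only [sq]
  simp only [covR, Matrix.of_apply, h0, zero_div, zero_sub] at hi
  have : 0 ≤ (∫ x, x i * f x) * (∫ x, x i * f x) / (∫ x, f x) ^ 2 :=
    div_nonneg (mul_self_nonneg _) (sq_nonneg _)
  linarith

lemma integrable_mul_of_covR_pos (hf : MulLogConcave f) (hpos : ∀ i, 0 < covR f i i)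
    (i j : Fin d) : Integrable fun x : Fin d → ℝ => x i * x j * f x := by
  have hfi := (integrable_of_covR_pos hf (hpos i)).1
  refine ((integrable_sq_of_covR_pos (hpos i)).add (integrable_sq_of_covR_pos (hpos j))).mono'
    ((by fun_prop : Continuous fun x : Fin d → ℝ => x i * x j).aestronglyMeasurable.mul
      hfi.aestronglyMeasurable) (ae_of_all _ fun x => ?_)
  rw [norm_mul, Real.norm_of_nonneg (hf.nonneg x), Pi.add_apply, ← add_mul, Real.norm_eq_abs]
  refine mul_le_mul_of_nonneg_right ?_ (hf.nonneg x)
  rw [abs_le]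
  constructor <;> nlinarith [sq_nonneg (x i + x j), sq_nonneg (x i - x j)]

lemma integrable_coord_of_covR_pos (hf : MulLogConcave f) (hpos : ∀ i, 0 < covR f i i)
    (i : Fin d) : Integrable fun x : Fin d → ℝ => x i * f x := by
  have hfi := (integrable_of_covR_pos hf (hpos i)).1
  refine ((integrable_sq_of_covR_pos (hpos i)).add hfi).mono'
    ((by fun_prop : Continuous fun x : Fin d → ℝ => x i).aestronglyMeasurable.mul
      hfi.aestronglyMeasurable) (ae_of_all _ fun x => ?_)
  rw [norm_mul, Real.norm_of_nonneg (hf.nonneg x), Pi.add_apply, ← add_one_mul, Real.norm_eq_abs]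
  refine mul_le_mul_of_nonneg_right ?_ (hf.nonneg x)
  rw [abs_le]
  constructor <;> nlinarith [sq_nonneg (x i + 1), sq_nonneg (x i - 1)]

lemma integral_sub_barycentre (hf : MulLogConcave f) (hpos : ∀ i, 0 < covR f i i) (i : Fin d) :
    ∫ x : Fin d → ℝ, (x i - barycentre f i) * f x = 0 := by
  obtain ⟨hfi, hI⟩ := integrable_of_covR_pos hf (hpos i)
  simp only [sub_mul]
  rw [integral_sub (integrable_coord_of_covR_pos hf hpos i) (hfi.const_mul _), integral_const_mul,
    barycentre, div_mul_cancel₀ _ hI.ne', sub_self]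

lemma integral_sub_mul_sub_barycentre (hf : MulLogConcave f) (hpos : ∀ i, 0 < covR f i i)
    (i j : Fin d) :
    Integrable (fun x : Fin d → ℝ => (x i - barycentre f i) * (x j - barycentre f j) * f x) ∧
    ∫ x : Fin d → ℝ, (x i - barycentre f i) * (x j - barycentre f j) * f x =
      (∫ x, f x) * covR f i j := by
  obtain ⟨hfi, hI⟩ := integrable_of_covR_pos hf (hpos i)
  set m := barycentre f with hm
  have h1 := integrable_mul_of_covR_pos hf hpos i j
  have h2 := (integrable_coord_of_covR_pos hf hpos i).const_mul (m j)
  have h3 := (integrable_coord_of_covR_pos hf hpos j).const_mul (m i)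
  have h4 := hfi.const_mul (m i * m j)
  have hexp : (fun x : Fin d → ℝ => (x i - m i) * (x j - m j) * f x) = fun x =>
      x i * x j * f x - m j * (x i * f x) - m i * (x j * f x) + m i * m j * f x := by
    ext x; ring
  rw [hexp]
  have h12 : Integrable fun x : Fin d → ℝ => x i * x j * f x - m j * (x i * f x) := h1.sub h2
  have h123 : Integrable fun x : Fin d → ℝ =>
      x i * x j * f x - m j * (x i * f x) - m i * (x j * f x) := h12.sub h3
  refine ⟨h123.add h4, ?_⟩
  rw [integral_add h123 h4, integral_sub h12 h3, integral_sub h1 h2,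
    integral_const_mul, integral_const_mul, integral_const_mul]
  simp only [hm, barycentre, covR, Matrix.of_apply]
  field_simp
  ring

lemma integral_sum_mul_sub_sq (hf : MulLogConcave f) (hpos : ∀ i, 0 < covR f i i)
    (θ : Fin d → ℝ) :
    ∫ x : Fin d → ℝ, (∑ i, θ i * (x i - barycentre f i)) ^ 2 * f x =
      (∫ x, f x) * ∑ i, ∑ j, θ i * θ j * covR f i j := by
  have hexp : (fun x : Fin d → ℝ => (∑ i, θ i * (x i - barycentre f i)) ^ 2 * f x) = fun x =>
      ∑ i, ∑ j, θ i * θ j * ((x i - barycentre f i) * (x j - barycentre f j) * f x) := by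
    ext x
    rw [sq, Finset.sum_mul_sum, Finset.sum_mul]
    refine Finset.sum_congr rfl fun i _ => ?_
    rw [Finset.sum_mul]
    exact Finset.sum_congr rfl fun j _ => by ring
  rw [hexp, integral_finsetSum _ fun i _ => integrable_finsetSum _ fun j _ =>
    (integral_sub_mul_sub_barycentre hf hpos i j).1.const_mul _, Finset.mul_sum]
  refine Finset.sum_congr rfl fun i _ => ?_
  rw [integral_finsetSum _ fun j _ =>
    (integral_sub_mul_sub_barycentre hf hpos i j).1.const_mul _, Finset.mul_sum]
  refine Finset.sum_congr rfl fun j _ => ?_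
  rw [integral_const_mul, (integral_sub_mul_sub_barycentre hf hpos i j).2]
  ring

/-- The deviation from σ² times the identity contributes at most A σ (∑|θᵢ|)² ≤ d A σ ∑θᵢ² by
Cauchy–Schwarz, and 2dA ≤ σ makes this at most half of the main term. -/
lemma AlmostIsotropic.le_sum_covR {A : ℝ} (h : AlmostIsotropic A f) (hA : 0 ≤ A)
    (hσ : 0 < sigmaR f) (hAσ : 2 * d * A ≤ sigmaR f) (θ : Fin d → ℝ) :
    sigmaR f ^ 2 / 2 * ∑ i, θ i ^ 2 ≤ ∑ i, ∑ j, θ i * θ j * covR f i j := by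
  set σ := sigmaR f with hσdef
  have hpt : ∀ i j, (if i = j then σ ^ 2 * θ i ^ 2 else 0) - |θ i| * |θ j| * (A * σ) ≤
      θ i * θ j * covR f i j := by
    intro i j
    by_cases hij : i = j
    · subst hij
      have h1 := (abs_le.1 (h.1 i)).1
      rw [if_pos rfl, abs_mul_abs_self]
      nlinarith [mul_self_nonneg (θ i)]
    · rw [if_neg hij, zero_sub, ← abs_mul]
      have h1 : |θ i * θ j * covR f i j| ≤ |θ i * θ j| * (A * σ) := by
        rw [abs_mul]; gcongr; exact h.2 i j hij
      linarith [neg_abs_le (θ i * θ j * covR f i j)]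
  have hsum := Finset.sum_le_sum fun i (_ : i ∈ Finset.univ) =>
    Finset.sum_le_sum fun j (_ : j ∈ Finset.univ) => hpt i j
  have hL : ∑ i, ∑ j, ((if i = j then σ ^ 2 * θ i ^ 2 else 0) - |θ i| * |θ j| * (A * σ)) =
      σ ^ 2 * ∑ i, θ i ^ 2 - (∑ i, |θ i|) ^ 2 * (A * σ) := by
    simp only [Finset.sum_sub_distrib, Finset.sum_ite_eq, Finset.mem_univ, if_true]
    rw [← Finset.mul_sum, sq (∑ i, |θ i|), Finset.sum_mul_sum, Finset.sum_mul]
    simp only [Finset.sum_mul]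
  rw [hL] at hsum
  have hcs := sq_sum_le_card_mul_sum_sq (s := Finset.univ) (f := fun i => |θ i|)
  simp only [sq_abs, Finset.card_univ, Fintype.card_fin] at hcs
  have h0 : 0 ≤ ∑ i, θ i ^ 2 := Finset.sum_nonneg fun i _ => sq_nonneg _
  have h1 : (∑ i, |θ i|) ^ 2 * (A * σ) ≤ d * (∑ i, θ i ^ 2) * (A * σ) := by gcongr
  have h2 : d * (∑ i, θ i ^ 2) * (A * σ) ≤ σ ^ 2 / 2 * ∑ i, θ i ^ 2 := by
    have h3 : d * (A * σ) ≤ σ ^ 2 / 2 := by nlinarith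
    nlinarith
  linarith

lemma AlmostIsotropic.nearIsotropicDensity {A : ℝ} (h : AlmostIsotropic A f) (hd : 1 ≤ d)
    (hf : MulLogConcave f) (hσ : 0 < sigmaR f) (hAσ : 2 * d * A ≤ sigmaR f) :
    0 < ∫ x, f x ∧ NearIsotropicDensity fun x =>
      sigmaR f ^ d / (∫ x, f x) * f (barycentre f + sigmaR f • x) := by
  have hd1 : (1 : ℝ) ≤ d := by exact_mod_cast hd
  have hA : 0 ≤ A := by
    have := (abs_nonneg _).trans (h.1 ⟨0, hd⟩)
    exact nonneg_of_mul_nonneg_left this hσ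
  have hAle : A * sigmaR f ≤ sigmaR f ^ 2 / 2 := by nlinarith
  have hdiag : ∀ i, 0 < covR f i i ∧ covR f i i ≤ 2 * sigmaR f ^ 2 := fun i => by
    have h1 := abs_le.1 (h.1 i)
    have h2 : 0 < sigmaR f ^ 2 := by positivity
    constructor <;> linarith
  have hpos := fun i => (hdiag i).1
  obtain ⟨hfi, hI⟩ := integrable_of_covR_pos hf (hpos ⟨0, hd⟩)
  refine ⟨hI, ?_⟩
  set σ := sigmaR f with hσdef
  set m := barycentre f with hm
  set I := ∫ x, f x with hIdef
  set K := σ ^ d / I with hK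
  have hK0 : 0 < K := by positivity
  have hKI : (σ ^ d)⁻¹ * (K * I) = 1 := by rw [hK]; field_simp
  have hcov := integral_sub_mul_sub_barycentre hf hpos
  have hsqfun : ∀ i, (fun x : Fin d → ℝ => x i ^ 2 * (K * f (m + σ • x))) = fun x =>
      K / σ ^ 2 * (((m + σ • x) i - m i) * ((m + σ • x) i - m i) * f (m + σ • x)) := fun i => by
    ext x
    simp only [Pi.add_apply, Pi.smul_apply, smul_eq_mul, add_sub_cancel_left]
    field_simp
  refine ⟨hf.const_mul_comp_add_smul hK0 m σ, ?_, ?_, fun i => ?_, fun i => ?_, fun i => ?_,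
    fun θ => ?_⟩
  · exact (Integrable.comp_add_smul hfi m hσ).const_mul K
  · rw [integral_comp_add_smul (fun y => K * f y) m hσ, integral_const_mul]
    exact hKI
  · have : (fun x : Fin d → ℝ => x i * (K * f (m + σ • x))) = fun x =>
        K / σ * (((m + σ • x) i - m i) * f (m + σ • x)) := by
      ext x
      simp only [Pi.add_apply, Pi.smul_apply, smul_eq_mul, add_sub_cancel_left]
      field_simp
    rw [this, integral_comp_add_smul (fun y => K / σ * ((y i - m i) * f y)) m hσ,
      integral_const_mul, integral_sub_barycentre hf hpos i]
    simp
  · rw [hsqfun]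
    exact Integrable.comp_add_smul ((hcov i i).1.const_mul _) m hσ
  · rw [hsqfun, integral_comp_add_smul
      (fun y => K / σ ^ 2 * ((y i - m i) * (y i - m i) * f y)) m hσ,
      integral_const_mul, (hcov i i).2]
    have : (σ ^ d)⁻¹ * (K / σ ^ 2 * (I * covR f i i)) = covR f i i / σ ^ 2 := by
      calc (σ ^ d)⁻¹ * (K / σ ^ 2 * (I * covR f i i))
          = (σ ^ d)⁻¹ * (K * I) * (covR f i i / σ ^ 2) := by ring
        _ = _ := by rw [hKI, one_mul]
    rw [this, div_le_iff₀ (by positivity)]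
    exact (hdiag i).2
  · have : (fun x : Fin d → ℝ => (∑ i, θ i * x i) ^ 2 * (K * f (m + σ • x))) = fun x =>
        K / σ ^ 2 * ((∑ i, θ i * ((m + σ • x) i - m i)) ^ 2 * f (m + σ • x)) := by
      ext x
      have hs : ∑ i, θ i * (σ * x i) = σ * ∑ i, θ i * x i := by
        rw [Finset.mul_sum]; exact Finset.sum_congr rfl fun i _ => by ring
      simp only [Pi.add_apply, Pi.smul_apply, smul_eq_mul, add_sub_cancel_left, hs]
      field_simp
    rw [this, integral_comp_add_smul
      (fun y => K / σ ^ 2 * ((∑ i, θ i * (y i - m i)) ^ 2 * f y)) m hσ, integral_const_mul,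
      integral_sum_mul_sub_sq hf hpos θ]
    have h2 : (σ ^ d)⁻¹ * (K / σ ^ 2 * (I * ∑ i, ∑ j, θ i * θ j * covR f i j)) =
        (∑ i, ∑ j, θ i * θ j * covR f i j) / σ ^ 2 := by
      calc _ = (σ ^ d)⁻¹ * (K * I) * ((∑ i, ∑ j, θ i * θ j * covR f i j) / σ ^ 2) := by ring
        _ = _ := by rw [hKI, one_mul]
    rw [h2, le_div_iff₀ (by positivity)]
    have := h.le_sum_covR hA hσ hAσ θ
    linarith

lemma le_sigmaR_of_pow_le_det (hd : 1 ≤ d) {s : ℝ} (hs : 0 ≤ s)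
    (h : s ^ (2 * d) ≤ (covR f).det) : s ≤ sigmaR f := by
  have h1 : (s ^ (2 * d)) ^ (((2 * d : ℕ) : ℝ)⁻¹) = s :=
    Real.pow_rpow_inv_natCast hs (by omega)
  calc s = (s ^ (2 * d)) ^ (((2 * d : ℕ) : ℝ)⁻¹) := h1.symm
    _ ≤ (covR f).det ^ (((2 * d : ℕ) : ℝ)⁻¹) := by gcongr
    _ = sigmaR f := by rw [sigmaR, one_div]; push_cast; rfl

end Rescaling

/-! ### Assembly -/

theorem mainTheorem3 (d : ℕ) (hd : 1 ≤ d) :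
    ∃ C : ℝ, 0 < C ∧
      ∀ A : ℝ, ∃ N : ℝ,
        ∀ (p : PMF (Fin d → ℤ)) (f : (Fin d → ℝ) → ℝ),
          IsLogConcaveExtension p f → AlmostIsotropic A f → N ≤ (covR f).det →
            ∀ k : Fin d → ℤ, (p k).toReal ≤ C / Real.sqrt (covZ p).det := by
  obtain ⟨c, t, κ, hc, ht, hκ, hprofile⟩ := NearIsotropicDensity.exists_profile d
  obtain ⟨C, σ₀, hC, hbound⟩ := exists_bound_of_profile hd hc ht hκ
  -- `C` is fixed before `A`. The threshold is the 2d-th power of the required lower bound on σ; the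
  -- entry 1 ensures σ > 0.
  refine ⟨C, hC, fun A => ⟨max 1 (max σ₀ (2 * d * A)) ^ (2 * d), fun p f hpf hiso hN => ?_⟩⟩
  have hmax := le_sigmaR_of_pow_le_det hd (zero_le_one.trans (le_max_left _ _)) hN
  have hσ : 0 < sigmaR f := one_pos.trans_le ((le_max_left _ _).trans hmax)
  have hσ₀ : σ₀ ≤ sigmaR f := ((le_max_left _ _).trans (le_max_right _ _)).trans hmax
  have hAσ : 2 * d * A ≤ sigmaR f := ((le_max_right _ _).trans (le_max_right _ _)).trans hmax
  obtain ⟨hI, hg⟩ := hiso.nearIsotropicDensity hd hpf.1.mulLogConcave hσ hAσ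
  obtain ⟨S, hS, hlow, hup⟩ := hprofile _ hg
  set σ := sigmaR f with hσdef
  set m := barycentre f with hm
  set K := σ ^ d / (∫ x, f x) with hK
  have hK0 : 0 < K := by positivity
  have hpt : ∀ k : Fin d → ℤ, f (m + σ • (σ⁻¹ • (latticeCast k - m))) = (p k).toReal := fun k => by
    rw [smul_inv_smul₀ hσ.ne', add_sub_cancel]
    exact hpf.2 k
  have hnorm : ∀ k : Fin d → ℤ, ‖σ⁻¹ • (latticeCast k - m)‖ = ‖latticeCast k - m‖ / σ := fun k => by
    rw [norm_smul, norm_inv, Real.norm_of_nonneg hσ.le, inv_mul_eq_div]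
  refine hbound σ hσ₀ hσ p m (S / K) (by positivity) (fun k hk => ?_) fun k => ?_
  · have h := hlow (σ⁻¹ • (latticeCast k - m)) (by rw [hnorm, div_le_iff₀ hσ]; exact hk)
    simp only [hpt] at h
    rw [← mul_div_assoc, div_le_iff₀ hK0]
    linarith
  · have h := hup (σ⁻¹ • (latticeCast k - m))
    simp only [hpt, hnorm] at h
    have he : -κ * (‖latticeCast k - m‖ / σ) = -(‖latticeCast k - m‖ / (σ / κ)) := by
      field_simp
    rw [he] at h
    have h2 : 8 * (S / K) * Real.exp (-(‖latticeCast k - m‖ / (σ / κ))) =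
        8 * S * Real.exp (-(‖latticeCast k - m‖ / (σ / κ))) / K := by ring
    rw [h2, le_div_iff₀ hK0]
    linarith
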